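/- Let $K\ge 1$, let $\mathcal X_1,\dots,\mathcal X_K$ (input alphabets) and $\mathcal Y_1,\dots,\mathcal Y_K$ (output alphabets) be non-empty standard Borel spaces, and let $P_{Y_1\cdots Y_K\mid X_1\cdots X_K}$ be a memoryless channel, i.e. a Markov kernel from $\prod_i\mathcal X_i$ to $\prod_i\mathcal Y_i$, used without feedback. In the $K$-user cognitive interference channel with cumulative message sharing, a code of block length $N$ and non-negative rate tuple $(R_1,\dots,R_K)$ (in bits) consists of independent messages $W_i$, uniform on the set of integers $[1:2^{NR_i}]$; encoders $X_i^N=f_i^{(N)}(W_1,\dots,W_i)\in\mathcal X_i^N$; and measurable decoders $\widehat W_i=g_i^{(N)}(Y_i^N)\in[1:2^{NR_i}]$, for $i\in[1:K]$. Its error probability is $P_e^{(N)}=\max_i\mathbb P[\widehat W_i\ne W_i]$. The capacity region $\mathcal C$ is the set of non-negative tuples $(R_1,\dots,R_K)$ for which there is a sequence of such codes, indexed by $N$, with $P_e^{(N)}\to 0$ as $N\to\infty$. Let $\mathcal R$ be the set of non-negative tuples $(R_1,\dots,R_K)$ for which there is a probability distribution $P_{X_1\cdots X_K}$ on $\prod_i\mathcal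 X_i$ such that, for every channel $Q_{Y_1\cdots Y_K\mid X_1\cdots X_K}$ with the same conditional marginals, $Q_{Y_i\mid X_1\cdots X_K}=P_{Y_i\mid X_1\cdots X_K}$ for all $i\in[1:K]$, and for every $i\in[1:K]$, $$R_i\le I(Y_i;X_i,\dots,X_K\mid X_1,\dots,X_{i-1}),$$ $$\sum_{j=i}^K R_j\le\sum_{j=i}^K I(Y_j;X_j,\dots,X_K\mid X_1,\dots,X_{j-1},Y_i,\dots,Y_{j-1}),$$ where the mutual informations (in bits, with values in $[0,\infty]$) are computed for $(X_1,\dots,X_K)\sim P_{X_1\cdots X_K}$ and $(Y_1,\dots,Y_K)$ produced from it by $Q$. (So one input distribution serves all the bounds, and each bound may be tightened separately over the channels with the given conditional marginals.) Then $\mathcal C\subseteq\mathcal R$ if all input alphabets $\mathcal X_i$ are finite (the output alphabets being arbitrary), and $\mathcal C\subseteq\overline{\mathcal R}$, the closure in $\mathbb R^K$, for arbitrary alphabets. -/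

import Mathlib

open MeasureTheory ProbabilityTheory Filter Topology
open scoped ENNReal

noncomputable section

namespace CIFC

/-- Conditional mutual information `I(A; B | C)` in bits of random variables on `(Ω, μ)`:
the Kullback-Leibler divergence of `P_{C,A,B}` from `P_C ⊗ (P_{A|C} × P_{B|C})`,
converted from nats to bits. It takes values in `[0, ∞]`. -/
def condMutualInfo {Ω α β γ : Type*} [MeasurableSpace Ω]
    [MeasurableSpace α] [StandardBorelSpace α] [Nonempty α]
    [MeasurableSpace β] [StandardBorelSpace β] [Nonempty β] [MeasurableSpace γ]
    (μ : Measure Ω) [IsFiniteMeasure μ] (A : Ω → α) (B : Ω → β) (C : Ω → γ) : ℝ≥0∞ :=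
  InformationTheory.klDiv (μ.map fun ω => (C ω, A ω, B ω))
      (μ.map C ⊗ₘ (condDistrib A C μ ×ₖ condDistrib B C μ))
    / ENNReal.ofReal (Real.log 2)

variable {K : ℕ} {X Y : Fin K → Type*}

/-- A block code of length `N` with `M i` messages for user `i`. Encoder `i` knows the messages of
users `1, …, i` (cumulative message sharing); decoder `i` observes only its own output block. -/
structure Code (X Y : Fin K → Type*) [∀ i, MeasurableSpace (Y i)] (M : Fin K → ℕ) (N : ℕ) where
  /-- Encoding functions. -/
  enc : ∀ i : Fin K, (∀ j : Set.Iic i, Fin (M j)) → Fin N → X i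
  /-- Decoding functions. -/
  dec : ∀ i : Fin K, (Fin N → Y i) → Fin (M i)
  measurable_dec : ∀ i, Measurable (dec i)

variable [∀ i, MeasurableSpace (X i)] [∀ i, MeasurableSpace (Y i)]

namespace Code

variable {M : Fin K → ℕ} {N : ℕ}

/-- The channel input at time `t` when the message tuple is `w`. -/
def input (c : Code X Y M N) (w : ∀ i, Fin (M i)) (t : Fin N) : ∀ i, X i :=
  fun i => c.enc i (fun j => w j) t

/-- The law of the output block given the message tuple `w`: the channel is memoryless and is used
without feedback. -/
def outputLaw (c : Code X Y M N) (ch : Kernel (∀ i, X i) (∀ i, Y i)) (w : ∀ i, Fin (M i)) :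
    Measure (Fin N → ∀ i, Y i) :=
  Measure.pi fun t => ch (c.input w t)

/-- The probability that receiver `i` decodes its message incorrectly, when the messages are
independent and uniformly distributed. -/
def userErrorProb (c : Code X Y M N) (ch : Kernel (∀ i, X i) (∀ i, Y i)) (i : Fin K) : ℝ≥0∞ :=
  (∑ w : ∀ i, Fin (M i), c.outputLaw ch w {y | c.dec i (fun t => y t i) ≠ w i})
    / Fintype.card (∀ i, Fin (M i))

/-- The error probability of the code: the largest error probability of a receiver. -/
def errorProb (c : Code X Y M N) (ch : Kernel (∀ i, X i) (∀ i, Y i)) : ℝ≥0∞ :=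
  ⨆ i, c.userErrorProb ch i

end Code

/-- The number of messages in `[1 : 2 ^ (N r)]`. -/
def numMessages (N : ℕ) (r : ℝ) : ℕ := ⌊(2 : ℝ) ^ ((N : ℝ) * r)⌋₊

/-- The capacity region: the non-negative rate tuples for which there is a sequence of codes, indexed
by the block length, whose error probability tends to zero. -/
def capacityRegion (ch : Kernel (∀ i, X i) (∀ i, Y i)) : Set (Fin K → ℝ) :=
  {R | (∀ i, 0 ≤ R i) ∧
    ∃ c : ∀ N : ℕ, Code X Y (fun i => numMessages N (R i)) N,
      Tendsto (fun N => (c N).errorProb ch) atTop (𝓝 0)}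

/-- Two channels with the same conditional marginals `P_{Y_i | X_1, …, X_K}` for every `i`. -/
def SameMarginals (ch ch' : Kernel (∀ i, X i) (∀ i, Y i)) : Prop :=
  ∀ i, ch'.map (fun y => y i) = ch.map (fun y => y i)

section Bounds

variable [∀ i, StandardBorelSpace (X i)] [∀ i, Nonempty (X i)]
  [∀ i, StandardBorelSpace (Y i)] [∀ i, Nonempty (Y i)]

/-- `I(Y_i; X_i, …, X_K | X_1, …, X_{i-1})` for the input distribution `P` and the channel `ch`. -/
def singleBound (P : Measure (∀ i, X i)) [IsProbabilityMeasure P]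
    (ch : Kernel (∀ i, X i) (∀ i, Y i)) [IsMarkovKernel ch] (i : Fin K) : ℝ≥0∞ :=
  condMutualInfo (P ⊗ₘ ch)
    (fun z => z.2 i)
    (fun z (l : Set.Ici i) => z.1 l)
    (fun z (l : Set.Iio i) => z.1 l)

/-- `I(Y_j; X_j, …, X_K | X_1, …, X_{j-1}, Y_i, …, Y_{j-1})` for the input distribution `P` and the
channel `ch`. -/
def progressiveTerm (P : Measure (∀ i, X i)) [IsProbabilityMeasure P]
    (ch : Kernel (∀ i, X i) (∀ i, Y i)) [IsMarkovKernel ch] (i j : Fin K) : ℝ≥0∞ :=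
  condMutualInfo (P ⊗ₘ ch)
    (fun z => z.2 j)
    (fun z (l : Set.Ici j) => z.1 l)
    (fun z => ((fun l : Set.Iio j => z.1 l), (fun l : Set.Ico i j => z.2 l)))

/-- The outer bound region: one input distribution `P` has to satisfy all the bounds, each of them
for every channel with the same conditional marginals as `ch`. -/
def outerRegion (ch : Kernel (∀ i, X i) (∀ i, Y i)) : Set (Fin K → ℝ) :=
  {R | (∀ i, 0 ≤ R i) ∧
    ∃ (P : Measure (∀ i, X i)) (_ : IsProbabilityMeasure P),
      ∀ (ch' : Kernel (∀ i, X i) (∀ i, Y i)) (_ : IsMarkovKernel ch'), SameMarginals ch ch' →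
        (∀ i, ENNReal.ofReal (R i) ≤ singleBound P ch' i) ∧
        ∀ i, ENNReal.ofReal (∑ j ∈ Finset.Ici i, R j) ≤
          ∑ j ∈ Finset.Ici i, progressiveTerm P ch' i j}

end Bounds

end CIFC

end

/-!
The converse is a change of measure. An information density of `I(Y_j; X_{≥ j} | X_{< j}, Y_s)` is
the log-likelihood ratio of the channel law with respect to the law in which `Y_j` is resampled from
a kernel `q_j` that sees only `(X_{< j}, Y_s)`. Resampling the outputs of a set `J` of users one
after the other, with `s` the preceding users of `J`, gives output laws that are causal in the
input: the outputs up to `j` only depend on the inputs before `j`, hence not on the message `W_j`.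
Under such laws every receiver can only guess its message, and testing them against the channel
law shows that `(1 - ∑ ε_j) ∑ log M_j - log 2` is at most the mean of the sum of the densities,
where user `j ∈ J` has `M_j` messages and error probability `ε_j`. The mean only involves the
empirical input law of the code, and the error probabilities only the conditional marginals of the
channel.

With the input law of the code as `P`, every code thus yields a point of `outerRegion`, up to a rate
loss that vanishes with the error probability: this is the bound by the closure. For finite
alphabets take for `P` a limit of the input laws. The densities for `P` are controlled only at the
atoms of `P`; mixing `q_j` with guesses of total weight `δ` extends the control to all inputs at the
cost of `-log (1 - δ)`, and `δ → 0` after the block length tends to infinity.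
-/

namespace CIFC

section ProductMeasures

variable {ι : Type*} [Fintype ι] {α β : ι → Type*} [∀ i, MeasurableSpace (α i)]
  [∀ i, MeasurableSpace (β i)]

lemma pi_mono {μ ν : ∀ i, Measure (α i)} (h : ∀ i, μ i ≤ ν i) :
    Measure.pi μ ≤ Measure.pi ν := by
  refine Measure.le_iff.2 fun s hs => ?_
  rw [Measure.pi, Measure.pi, toMeasure_apply _ _ hs, toMeasure_apply _ _ hs]
  refine OuterMeasure.le_pi.2 (fun t _ => ?_) s
  exact (OuterMeasure.pi_pi_le _ _).trans (Finset.prod_le_prod' fun i _ => h i _)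

lemma pi_withDensity (μ : ∀ i, Measure (α i)) [∀ i, IsProbabilityMeasure (μ i)]
    {f : ∀ i, α i → ℝ≥0∞} (hf : ∀ i, Measurable (f i))
    [∀ i, SigmaFinite ((μ i).withDensity (f i))] :
    Measure.pi (fun i => (μ i).withDensity (f i)) =
      (Measure.pi μ).withDensity fun y => ∏ i, f i (y i) := by
  refine Measure.pi_eq fun s hs => ?_
  have hfs : ∀ i, Measurable ((s i).indicator (f i)) := fun i => (hf i).indicator (hs i)
  calc (Measure.pi μ).withDensity (fun y => ∏ i, f i (y i)) (Set.univ.pi s)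
      = ∫⁻ y, ∏ i, (s i).indicator (f i) (y i) ∂Measure.pi μ := by
        rw [withDensity_apply _ (.univ_pi hs), ← lintegral_indicator (.univ_pi hs)]
        refine lintegral_congr fun y => ?_
        by_cases hy : ∀ i, y i ∈ s i
        · simp [Set.indicator_of_mem, Set.mem_pi, hy]
        · obtain ⟨i, hi⟩ := not_forall.1 hy
          rw [Set.indicator_of_notMem (by simpa [Set.mem_pi] using hy),
            Finset.prod_eq_zero (Finset.mem_univ i) (Set.indicator_of_notMem hi (f i))]
    _ = ∏ i, ∫⁻ y, (s i).indicator (f i) y ∂μ i := by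
        rw [lintegral_prod_eq_prod_lintegral_of_indepFun Finset.univ
          (fun i (y : ∀ i, α i) => (s i).indicator (f i) (y i))
          (iIndepFun_pi fun i => (hfs i).aemeasurable)
          fun i => (hfs i).comp (measurable_pi_apply i)]
        exact Finset.prod_congr rfl fun i _ =>
          (measurePreserving_eval μ i).lintegral_comp (hfs i)
    _ = ∏ i, (μ i).withDensity (f i) (s i) :=
        Finset.prod_congr rfl fun i _ => by
          rw [withDensity_apply _ (hs i), lintegral_indicator (hs i)]

variable {μ ν : ∀ i, Measure (α i)} {r : ∀ i, α i → β i}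

lemma pi_apply_mono_of_map_le [∀ i, IsFiniteMeasure (μ i)] [∀ i, IsFiniteMeasure (ν i)]
    (hr : ∀ i, Measurable (r i)) (h : ∀ i, (μ i).map (r i) ≤ (ν i).map (r i))
    {E : Set (∀ i, α i)} (hE : MeasurableSet[.comap (fun y i => r i (y i)) .pi] E) :
    Measure.pi μ E ≤ Measure.pi ν E := by
  have hrm : Measurable fun (y : ∀ i, α i) i => r i (y i) :=
    measurable_pi_lambda _ fun i => (hr i).comp (measurable_pi_apply i)
  obtain ⟨B, hB, rfl⟩ := hE
  rw [← Measure.map_apply hrm hB, ← Measure.map_apply hrm hB,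
    Measure.pi_map_pi fun i => (hr i).aemeasurable, Measure.pi_map_pi fun i => (hr i).aemeasurable]
  exact pi_mono h B

lemma pi_apply_eq_of_map_eq [∀ i, IsFiniteMeasure (μ i)] [∀ i, IsFiniteMeasure (ν i)]
    (hr : ∀ i, Measurable (r i)) (h : ∀ i, (μ i).map (r i) = (ν i).map (r i))
    {E : Set (∀ i, α i)} (hE : MeasurableSet[.comap (fun y i => r i (y i)) .pi] E) :
    Measure.pi μ E = Measure.pi ν E :=
  (pi_apply_mono_of_map_le hr (fun i => (h i).le) hE).antisymm
    (pi_apply_mono_of_map_le hr (fun i => (h i).ge) hE)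

lemma setLIntegral_prod_le_pi_of_map_le [∀ i, IsProbabilityMeasure (μ i)]
    [∀ i, IsFiniteMeasure (ν i)] {f : ∀ i, α i → ℝ≥0∞} (hf : ∀ i, Measurable (f i))
    (hr : ∀ i, Measurable (r i))
    (h : ∀ i, ((μ i).withDensity (f i)).map (r i) ≤ (ν i).map (r i))
    {E : Set (∀ i, α i)} (hE : MeasurableSet[.comap (fun y i => r i (y i)) .pi] E) :
    ∫⁻ y in E, ∏ i, f i (y i) ∂Measure.pi μ ≤ Measure.pi ν E := by
  have hfin : ∀ i, IsFiniteMeasure ((μ i).withDensity (f i)) := fun i => by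
    refine ⟨lt_of_le_of_lt ?_ (measure_lt_top (ν i) Set.univ)⟩
    simpa [Measure.map_apply (hr i) MeasurableSet.univ] using h i Set.univ
  have hrm : Measurable fun (y : ∀ i, α i) i => r i (y i) :=
    measurable_pi_lambda _ fun i => (hr i).comp (measurable_pi_apply i)
  rw [← withDensity_apply _ (hrm.comap_le _ hE), ← pi_withDensity μ hf]
  exact pi_apply_mono_of_map_le hr h hE

end ProductMeasures

section HypothesisTesting

lemma log_le_half_sub_one_add_log_two {u : ℝ} (hu : 0 < u) :
    Real.log u ≤ u / 2 - 1 + Real.log 2 := by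
  have h := Real.log_le_sub_one_of_pos (half_pos hu)
  rw [Real.log_div hu.ne' two_ne_zero] at h
  linarith

lemma indicator_log_le {Ω : Type*} {L : Ω → ℝ} {E : Set Ω} {m : ℝ} (hm : 0 < m) (ω : Ω) :
    E.indicator (fun _ => Real.log m) ω ≤ L ω +
      ((Real.exp (-L ω) + m * E.indicator (fun ω => Real.exp (-L ω)) ω) / 2 +
        (Real.log 2 - 1)) := by
  have he := Real.exp_pos (-L ω)
  by_cases hω : ω ∈ E
  · have h := log_le_half_sub_one_add_log_two (mul_pos hm he)
    rw [Real.log_mul hm.ne' he.ne', Real.log_exp] at h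
    simp only [Set.indicator_of_mem hω]
    linarith
  · have h := log_le_half_sub_one_add_log_two he
    rw [Real.log_exp] at h
    simp only [Set.indicator_of_notMem hω]
    linarith

variable {Ω : Type*} [MeasurableSpace Ω] {P : Measure Ω}

lemma integral_le_toReal_of_lintegral_ofReal_le {f : Ω → ℝ} (hf : AEStronglyMeasurable f P)
    (hf0 : ∀ ω, 0 ≤ f ω) {b : ℝ≥0∞} (hb : b ≠ ∞) (h : ∫⁻ ω, ENNReal.ofReal (f ω) ∂P ≤ b) :
    ∫ ω, f ω ∂P ≤ b.toReal := by
  rw [integral_eq_lintegral_of_nonneg_ae (ae_of_all _ hf0) hf]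
  exact ENNReal.toReal_mono hb h

/-- `L` plays the role of the log-likelihood ratio of `P` with respect to a law under which `E` has
probability at most `b`; the choice `m ≈ 1 / b` then bounds `P E` by the divergence `∫ L ∂P`. -/
lemma log_mul_measureReal_le_integral_add [IsProbabilityMeasure P] {L : Ω → ℝ}
    (hL : Integrable L P) {E : Set Ω} (hE : MeasurableSet E) {m : ℝ} (hm : 0 < m) {b : ℝ≥0∞}
    (hb : b ≠ ∞) (h_univ : ∫⁻ ω, ENNReal.ofReal (Real.exp (-L ω)) ∂P ≤ 1)
    (h_event : ∫⁻ ω in E, ENNReal.ofReal (Real.exp (-L ω)) ∂P ≤ b) :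
    Real.log m * P.real E ≤ ∫ ω, L ω ∂P + (m * b.toReal - 1) / 2 + Real.log 2 := by
  set e : Ω → ℝ := fun ω => Real.exp (-L ω)
  have he : AEStronglyMeasurable e P := Real.continuous_exp.comp_aestronglyMeasurable hL.1.neg
  have he_nonneg : ∀ ω, 0 ≤ e ω := fun ω => Real.exp_nonneg _
  have he_int : Integrable e P :=
    ⟨he, (hasFiniteIntegral_iff_ofReal (ae_of_all _ he_nonneg)).2
      (h_univ.trans_lt ENNReal.one_lt_top)⟩
  have he_univ : ∫ ω, e ω ∂P ≤ 1 :=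
    integral_le_toReal_of_lintegral_ofReal_le he he_nonneg ENNReal.one_ne_top h_univ
  have he_event : ∫ ω in E, e ω ∂P ≤ b.toReal :=
    integral_le_toReal_of_lintegral_ofReal_le he.restrict he_nonneg hb h_event
  have hme_int : Integrable (fun ω => m * E.indicator e ω) P := (he_int.indicator hE).const_mul m
  have hmean_int : Integrable (fun ω => (e ω + m * E.indicator e ω) / 2) P :=
    (he_int.add hme_int).div_const 2
  have hbound_int : Integrable
      (fun ω => (e ω + m * E.indicator e ω) / 2 + (Real.log 2 - 1)) P :=
    hmean_int.add (integrable_const _)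
  calc Real.log m * P.real E
      = ∫ ω, E.indicator (fun _ => Real.log m) ω ∂P := by
        rw [integral_indicator_const _ hE, smul_eq_mul, mul_comm]
    _ ≤ ∫ ω, L ω + ((e ω + m * E.indicator e ω) / 2 + (Real.log 2 - 1)) ∂P :=
        integral_mono ((integrable_const _).indicator hE) (hL.add hbound_int)
          (indicator_log_le hm)
    _ = ∫ ω, L ω ∂P + ((∫ ω, e ω ∂P + m * ∫ ω in E, e ω ∂P) / 2 + (Real.log 2 - 1)) := by
        rw [integral_add hL hbound_int, integral_add hmean_int (integrable_const _), integral_div,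
          integral_add he_int hme_int, integral_const_mul, integral_indicator hE, integral_const,
          probReal_univ, one_smul]
    _ ≤ ∫ ω, L ω ∂P + (m * b.toReal - 1) / 2 + Real.log 2 := by
        linarith [mul_le_mul_of_nonneg_left he_event hm.le]

end HypothesisTesting

section PiHypothesisTest

variable {ι : Type*} [Fintype ι] {α β : ι → Type*} [∀ i, MeasurableSpace (α i)]
  [∀ i, MeasurableSpace (β i)] {μ : ∀ i, Measure (α i)} [∀ i, IsProbabilityMeasure (μ i)]
  {D : ∀ i, α i → ℝ}

lemma integrable_sum_comp_eval (hD : ∀ i, Integrable (D i) (μ i)) :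
    Integrable (fun y => ∑ i, D i (y i)) (Measure.pi μ) :=
  integrable_finsetSum _ fun i _ => integrable_comp_eval (hD i)

lemma integral_sum_comp_eval (hD : ∀ i, Integrable (D i) (μ i)) :
    ∫ y, ∑ i, D i (y i) ∂Measure.pi μ = ∑ i, ∫ y, D i y ∂μ i := by
  rw [integral_finsetSum _ fun i _ => integrable_comp_eval (hD i)]
  exact Finset.sum_congr rfl fun i _ => integral_comp_eval (hD i).1

theorem log_mul_measureReal_pi_le_sum_integral_add {ν : ∀ i, Measure (α i)}
    [∀ i, IsProbabilityMeasure (ν i)] (hDm : ∀ i, Measurable (D i))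
    (hD : ∀ i, Integrable (D i) (μ i)) {r : ∀ i, α i → β i} (hr : ∀ i, Measurable (r i))
    (h : ∀ i, ((μ i).withDensity fun y => .ofReal (Real.exp (-D i y))).map (r i) ≤
      (ν i).map (r i))
    {E : Set (∀ i, α i)} (hE : MeasurableSet[.comap (fun y i => r i (y i)) .pi] E) {m : ℝ}
    (hm : 0 < m) :
    Real.log m * (Measure.pi μ).real E ≤
      ∑ i, ∫ y, D i y ∂μ i + (m * (Measure.pi ν).real E - 1) / 2 + Real.log 2 := by
  have hexp : ∀ y : ∀ i, α i, ENNReal.ofReal (Real.exp (-∑ i, D i (y i))) =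
      ∏ i, ENNReal.ofReal (Real.exp (-D i (y i))) := fun y => by
    rw [← ENNReal.ofReal_prod_of_nonneg fun _ _ => Real.exp_nonneg _, ← Real.exp_sum,
      Finset.sum_neg_distrib]
  have hle : ∀ F, MeasurableSet[.comap (fun (y : ∀ i, α i) i => r i (y i)) .pi] F →
      ∫⁻ y in F, .ofReal (Real.exp (-∑ i, D i (y i))) ∂Measure.pi μ ≤ Measure.pi ν F :=
    fun F hF => by
      simp only [hexp]
      exact setLIntegral_prod_le_pi_of_map_le (fun i => (hDm i).neg.exp.ennreal_ofReal) hr h hF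
  have hEm : MeasurableSet E := Measurable.comap_le (by fun_prop) _ hE
  rw [← integral_sum_comp_eval hD]
  refine log_mul_measureReal_le_integral_add (integrable_sum_comp_eval hD) hEm hm
    (measure_ne_top _ _) ?_ (hle E hE)
  simpa using hle Set.univ MeasurableSet.univ

end PiHypothesisTest

section CausalBounds

variable {ι : Type*} [LinearOrder ι] {X Y : ι → Type*} [∀ i, MeasurableSpace (Y i)]

lemma exists_measurable_domRestrict_update {s t : Set ι} {j : ι} (h : s ⊆ insert j t) :
    ∃ e : (∀ l : t, Y l) × Y j → ∀ l : s, Y l, Measurable e ∧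
      ∀ y a, e (t.domRestrict y, a) = s.domRestrict (Function.update y j a) := by
  classical
  have hmem : ∀ l : s, (l : ι) ≠ j → (l : ι) ∈ t := fun l hl => (h l.2).resolve_left hl
  refine ⟨fun p l => if hl : (l : ι) = j then hl ▸ p.2 else p.1 ⟨l, hmem l hl⟩,
    measurable_pi_lambda _ fun l => ?_, fun y a => funext fun l => ?_⟩
  · obtain ⟨l, hls⟩ := l
    by_cases hl : l = j
    · subst hl
      simpa using measurable_snd
    · simp only [hl, dite_false]
      fun_prop
  · obtain ⟨l, hls⟩ := l
    by_cases hl : l = j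
    · subst hl
      simp
    · simp [hl]

/-- The output laws `Q x` are causal in the input `x`: the outputs up to `m` only depend on the
inputs before `m`. -/
def IsCausal (Q : (∀ i, X i) → Measure (∀ i, Y i)) : Prop :=
  ∀ m x x', (∀ l < m, x l = x' l) →
    (Q x).map (Set.Iic m).domRestrict = (Q x').map (Set.Iic m).domRestrict

lemma IsCausal.lintegral_eq {Q : (∀ i, X i) → Measure (∀ i, Y i)} (hQ : IsCausal Q) {m : ι}
    {x x' : ∀ i, X i} (hx : ∀ l < m, x l = x' l) {F : (∀ l : Set.Iic m, Y l) → ℝ≥0∞}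
    (hF : Measurable F) :
    ∫⁻ y, F ((Set.Iic m).domRestrict y) ∂Q x = ∫⁻ y, F ((Set.Iic m).domRestrict y) ∂Q x' := by
  rw [← lintegral_map hF (Set.measurable_restrict _), hQ m x x' hx,
    lintegral_map hF (Set.measurable_restrict _)]

variable [∀ i, MeasurableSpace (X i)]

/-- The law obtained from `μ` by replacing the output `j` with a sample from `q`, which sees only
the inputs before `j` and the outputs in `s`. -/
noncomputable def resample {s : Set ι} {j : ι}
    (q : Kernel ((∀ l : Set.Iio j, X l) × ∀ l : s, Y l) (Y j)) (x : ∀ i, X i)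
    (μ : Measure (∀ i, Y i)) : Measure (∀ i, Y i) :=
  (μ ⊗ₘ q.comap (fun y => ((Set.Iio j).domRestrict x, s.domRestrict y)) (by fun_prop)).map
    fun p => Function.update p.1 j p.2

section Resample

variable {s : Set ι} {j : ι} (q : Kernel ((∀ l : Set.Iio j, X l) × ∀ l : s, Y l) (Y j))
  [IsMarkovKernel q] (x : ∀ i, X i) (μ : Measure (∀ i, Y i))

instance [IsProbabilityMeasure μ] : IsProbabilityMeasure (resample q x μ) :=
  Measure.isProbabilityMeasure_map measurable_update'.aemeasurable

lemma lintegral_resample [SFinite μ] {F : (∀ i, Y i) → ℝ≥0∞} (hF : Measurable F) :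
    ∫⁻ y, F y ∂resample q x μ =
      ∫⁻ y, ∫⁻ a, F (Function.update y j a)
        ∂q ((Set.Iio j).domRestrict x, s.domRestrict y) ∂μ := by
  have hu : Measurable fun p : (∀ i, Y i) × Y j => Function.update p.1 j p.2 := measurable_update'
  rw [resample, lintegral_map hF hu,
    Measure.lintegral_compProd (f := fun p => F (Function.update p.1 j p.2)) (hF.comp hu)]
  rfl

end Resample

lemma IsCausal.resample {Q : (∀ i, X i) → Measure (∀ i, Y i)} [∀ x, IsProbabilityMeasure (Q x)]
    (hQ : IsCausal Q) {s : Set ι} {j : ι} (hs : s ⊆ Set.Iio j)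
    (q : Kernel ((∀ l : Set.Iio j, X l) × ∀ l : s, Y l) (Y j)) [IsMarkovKernel q] :
    IsCausal fun x => resample q x (Q x) := by
  intro m x x' hx
  have hm : Measurable fun y : ∀ i, Y i => (Set.Iic m).domRestrict y :=
    Set.measurable_restrict _
  refine Measure.ext_of_lintegral _ fun F hF => ?_
  have hFm : Measurable fun y : ∀ i, Y i => F ((Set.Iic m).domRestrict y) := hF.comp hm
  rw [lintegral_map hF hm, lintegral_map hF hm, lintegral_resample _ _ _ hFm,
    lintegral_resample _ _ _ hFm]
  rcases lt_or_ge m j with hmj | hjm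
  · have hupdate : ∀ (y : ∀ i, Y i) a, (Set.Iic m).domRestrict (Function.update y j a) =
        (Set.Iic m).domRestrict y := fun y a => funext fun l =>
      Function.update_of_ne (ne_of_lt (lt_of_le_of_lt l.2 hmj)) _ _
    simpa [hupdate] using hQ.lintegral_eq hx hF
  · have hsm : s ⊆ Set.Iic m := fun l hl => ((hs hl).trans_le hjm).le
    obtain ⟨e, he, he_update⟩ := exists_measurable_domRestrict_update (Y := Y)
      (Set.subset_insert j (Set.Iic m))
    have hH : Measurable fun v : ∀ l : Set.Iic m, Y l =>
        ∫⁻ a, F (e (v, a)) ∂q ((Set.Iio j).domRestrict x, Set.domRestrict₂ hsm v) :=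
      Measurable.lintegral_kernel_prod_right' (f := fun p => F (e p)) (hF.comp he)
        (κ := q.comap (fun v => ((Set.Iio j).domRestrict x, Set.domRestrict₂ hsm v)) (by fun_prop))
    have hxj : (Set.Iio j).domRestrict x = (Set.Iio j).domRestrict x' :=
      funext fun l => hx l (l.2.trans_le hjm)
    simp only [← he_update, ← hxj]
    exact hQ.lintegral_eq hx hH

/-- The log-likelihood ratio `ℓ x` of the outputs `(Y_s, Y_j)` is causally bounded on the inputs in
`A`: integrating `exp (-ℓ x)` against the channel law amounts at most to resampling the output `j`
from the kernel `q`, which sees only the inputs before `j` and the outputs in `s`. -/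
structure IsCausalBound (ch : Kernel (∀ i, X i) (∀ i, Y i)) (A : Set (∀ i, X i)) (s : Set ι) (j : ι)
    (ℓ : (∀ i, X i) → (∀ l : s, Y l) × Y j → ℝ)
    (q : Kernel ((∀ l : Set.Iio j, X l) × ∀ l : s, Y l) (Y j)) : Prop where
  isMarkovKernel : IsMarkovKernel q
  measurable : ∀ x ∈ A, Measurable (ℓ x)
  integrable : ∀ x ∈ A, Integrable (fun y => ℓ x (s.domRestrict y, y j)) (ch x)
  lintegral_le : ∀ x ∈ A, ∀ F : (∀ l : s, Y l) × Y j → ℝ≥0∞, Measurable F →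
    ∫⁻ y, F (s.domRestrict y, y j) * .ofReal (Real.exp (-ℓ x (s.domRestrict y, y j))) ∂ch x ≤
      ∫⁻ y, ∫⁻ a, F (s.domRestrict y, a)
        ∂q ((Set.Iio j).domRestrict x, s.domRestrict y) ∂ch x

lemma IsCausalBound.lintegral_le_lintegral_resample {ch : Kernel (∀ i, X i) (∀ i, Y i)}
    {A : Set (∀ i, X i)} {s : Set ι} {j : ι} {ℓ : (∀ i, X i) → (∀ l : s, Y l) × Y j → ℝ}
    {q : Kernel ((∀ l : Set.Iio j, X l) × ∀ l : s, Y l) (Y j)} (h : IsCausalBound ch A s j ℓ q)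
    {x : ∀ i, X i} (hx : x ∈ A) {μ : Measure (∀ i, Y i)} [SFinite μ]
    {g : (∀ l : s, Y l) → ℝ≥0∞} (hg : Measurable g)
    (hμ : ∀ F : (∀ l : s, Y l) → ℝ≥0∞, Measurable F →
      ∫⁻ y, F (s.domRestrict y) * g (s.domRestrict y) ∂ch x ≤ ∫⁻ y, F (s.domRestrict y) ∂μ)
    {t : Set ι} (ht : t ⊆ insert j s) {F : (∀ l : t, Y l) → ℝ≥0∞} (hF : Measurable F) :
    ∫⁻ y, F (t.domRestrict y) * (g (s.domRestrict y) *
        .ofReal (Real.exp (-ℓ x (s.domRestrict y, y j)))) ∂ch x ≤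
      ∫⁻ y, F (t.domRestrict y) ∂resample q x μ := by
  have := h.isMarkovKernel
  obtain ⟨e, he, he_update⟩ := exists_measurable_domRestrict_update (Y := Y) ht
  have he_self : ∀ y : ∀ i, Y i, e (s.domRestrict y, y j) = t.domRestrict y := fun y => by
    rw [he_update, Function.update_eq_self]
  have hFe : Measurable fun p => F (e p) := hF.comp he
  set c := (Set.Iio j).domRestrict x
  have hH : Measurable fun v => ∫⁻ a, F (e (v, a)) ∂q (c, v) :=
    hFe.lintegral_kernel_prod_right' (κ := q.comap (fun v => (c, v)) (by fun_prop))
  calc ∫⁻ y, F (t.domRestrict y) * (g (s.domRestrict y) *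
        .ofReal (Real.exp (-ℓ x (s.domRestrict y, y j)))) ∂ch x
      = ∫⁻ y, F (e (s.domRestrict y, y j)) * g (s.domRestrict y) *
          .ofReal (Real.exp (-ℓ x (s.domRestrict y, y j))) ∂ch x := by
        simp only [he_self, mul_assoc]
    _ ≤ ∫⁻ y, ∫⁻ a, F (e (s.domRestrict y, a)) * g (s.domRestrict y)
          ∂q (c, s.domRestrict y) ∂ch x :=
        h.lintegral_le x hx (fun p => F (e p) * g p.1) (by fun_prop)
    _ = ∫⁻ y, (∫⁻ a, F (e (s.domRestrict y, a)) ∂q (c, s.domRestrict y)) * g (s.domRestrict y)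
          ∂ch x :=
        lintegral_congr fun y => lintegral_mul_const _ (hFe.comp measurable_prodMk_left)
    _ ≤ ∫⁻ y, ∫⁻ a, F (e (s.domRestrict y, a)) ∂q (c, s.domRestrict y) ∂μ := hμ _ hH
    _ = ∫⁻ y, F (t.domRestrict y) ∂resample q x μ := by
        have hFt : Measurable fun y : ∀ i, Y i => F (t.domRestrict y) := by fun_prop
        simp only [lintegral_resample _ _ _ hFt, he_update, c]

end CausalBounds

lemma map_withDensity_le_map {α β : Type*} [MeasurableSpace α] [MeasurableSpace β]
    {μ ν : Measure α} {g : α → ℝ≥0∞} {r : α → β} (hr : Measurable r)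
    (h : ∀ F : β → ℝ≥0∞, Measurable F → ∫⁻ y, F (r y) * g y ∂μ ≤ ∫⁻ y, F (r y) ∂ν) :
    (μ.withDensity g).map r ≤ ν.map r := by
  refine Measure.le_iff.2 fun s hs => ?_
  have hF := h (s.indicator 1) (measurable_one.indicator hs)
  rw [Measure.map_apply hr hs, Measure.map_apply hr hs, withDensity_apply _ (hr hs),
    ← lintegral_indicator_one (hr hs), ← lintegral_indicator (hr hs)]
  refine le_trans (le_of_eq (lintegral_congr fun y => ?_)) hF
  by_cases hy : r y ∈ s <;> simp [hy]

lemma exists_measurable_ofReal_exp_neg_sum_eq {ι : Type*} {Y : ι → Type*}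
    [∀ i, MeasurableSpace (Y i)] {J : Finset ι} {s : ι → Set ι} {t : Set ι}
    (ht : ∀ j ∈ J, insert j (s j) ⊆ t) {ℓ : ∀ j, (∀ l : s j, Y l) × Y j → ℝ}
    (hℓ : ∀ j ∈ J, Measurable (ℓ j)) :
    ∃ g : (∀ l : t, Y l) → ℝ≥0∞, Measurable g ∧ ∀ y : ∀ i, Y i,
      .ofReal (Real.exp (-∑ j ∈ J, ℓ j ((s j).domRestrict y, y j))) = g (t.domRestrict y) := by
  have hjt : ∀ j : J, (j : ι) ∈ t := fun j => ht j j.2 (Set.mem_insert _ _)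
  have hst : ∀ j : J, s j ⊆ t := fun j => (Set.subset_insert _ _).trans (ht j j.2)
  refine ⟨fun v => .ofReal (Real.exp
    (-∑ j : J, ℓ j (Set.domRestrict₂ (hst j) v, v ⟨j, hjt j⟩))), ?_, fun y => ?_⟩
  · refine (Real.measurable_exp.comp (Finset.measurable_sum _ fun j _ => ?_).neg).ennreal_ofReal
    exact (hℓ j j.2).comp (by fun_prop)
  · rw [← Finset.sum_coe_sort J]
    rfl

section CausalBounds

variable {ι : Type*} [LinearOrder ι] {X Y : ι → Type*} [∀ i, MeasurableSpace (X i)]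
  [∀ i, MeasurableSpace (Y i)]

/-- The outputs in `J` are drawn one after the other, `Y j` from the kernel `q j`. -/
theorem exists_isCausal_lintegral_le [∀ i, Nonempty (Y i)] {ch : Kernel (∀ i, X i) (∀ i, Y i)}
    [IsMarkovKernel ch] {A : Set (∀ i, X i)} {J : Finset ι} {s : ι → Set ι}
    (hs : ∀ j ∈ J, s j = {l | l ∈ J ∧ l < j})
    {ℓ : ∀ j, (∀ i, X i) → (∀ l : s j, Y l) × Y j → ℝ}
    {q : ∀ j, Kernel ((∀ l : Set.Iio j, X l) × ∀ l : s j, Y l) (Y j)}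
    (h : ∀ j ∈ J, IsCausalBound ch A (s j) j (ℓ j) (q j)) :
    ∃ Q : (∀ i, X i) → Measure (∀ i, Y i), (∀ x, IsProbabilityMeasure (Q x)) ∧ IsCausal Q ∧
      ∀ x ∈ A, ∀ t : Set ι, t ⊆ J → ∀ F : (∀ l : t, Y l) → ℝ≥0∞, Measurable F →
        ∫⁻ y, F (t.domRestrict y) *
            .ofReal (Real.exp (-∑ j ∈ J, ℓ j x ((s j).domRestrict y, y j))) ∂ch x ≤
          ∫⁻ y, F (t.domRestrict y) ∂Q x := by
  induction J using Finset.induction_on_max with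
  | empty =>
    refine ⟨fun _ => Measure.dirac fun i => Classical.arbitrary (Y i), fun _ => inferInstance,
      fun _ _ _ _ => rfl, fun x _ t ht F _ => ?_⟩
    obtain rfl : t = ∅ := by simpa using ht
    have hF : ∀ v w, F v = F w := fun v w => congrArg F (Subsingleton.elim v w)
    simp [fun y : ∀ i, Y i => hF ((∅ : Set ι).domRestrict y) default]
  | insert j J hJ ih =>
    have hsj : s j = J := by
      rw [hs j (Finset.mem_insert_self j J)]
      grind
    have hsJ : ∀ i ∈ J, s i = {l | l ∈ J ∧ l < i} := fun i hi => by
      rw [hs i (Finset.mem_insert_of_mem hi)]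
      grind
    obtain ⟨Q, hQ_prob, hQ, hQ_le⟩ := ih hsJ fun l hl => h l (Finset.mem_insert_of_mem hl)
    have hj := h j (Finset.mem_insert_self j J)
    have := hj.isMarkovKernel
    refine ⟨fun x => resample (q j) x (Q x), fun x => inferInstance,
      hQ.resample (fun l hl => hJ l (by rwa [hsj] at hl)) (q j), fun x hx t ht F hF => ?_⟩
    obtain ⟨g, hg, hg_eq⟩ := exists_measurable_ofReal_exp_neg_sum_eq (J := J) (t := s j)
      (fun i hi => by rw [hsj, hsJ i hi]; exact Set.insert_subset hi fun l hl => hl.1)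
      (fun i hi => (h i (Finset.mem_insert_of_mem hi)).measurable x hx)
    have hsum : ∀ y, ENNReal.ofReal (Real.exp
          (-∑ l ∈ insert j J, ℓ l x ((s l).domRestrict y, y l))) =
        g ((s j).domRestrict y) * .ofReal (Real.exp (-ℓ j x ((s j).domRestrict y, y j))) :=
      fun y => by
        rw [Finset.sum_insert fun hjJ => (hJ j hjJ).false, neg_add, add_comm, Real.exp_add,
          ENNReal.ofReal_mul (Real.exp_nonneg _), hg_eq]
    have hQx := hQ_le x hx
    simp only [hg_eq] at hQx
    simp only [hsum]
    exact hj.lintegral_le_lintegral_resample hx hg (hQx _ hsj.le) (by simpa [hsj] using ht) hF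

end CausalBounds

/-- The mean of `ℓ x` under the output law at the input `x`; for an information density it is the
conditional information at `x`. -/
noncomputable def condMean {ι : Type*} {X Y : ι → Type*} [∀ i, MeasurableSpace (X i)]
    [∀ i, MeasurableSpace (Y i)] (ch : Kernel (∀ i, X i) (∀ i, Y i)) (s : Set ι) (j : ι)
    (ℓ : (∀ i, X i) → (∀ l : s, Y l) × Y j → ℝ) (x : ∀ i, X i) : ℝ :=
  ∫ y, ℓ x (s.domRestrict y, y j) ∂ch x

lemma sum_sum_update {ι : Type*} [Fintype ι] [DecidableEq ι] {α : ι → Type*} [∀ i, Fintype (α i)]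
    {β : Type*} [CommSemiring β] (φ : (∀ i, α i) → β) (i : ι) :
    ∑ w, ∑ a : α i, φ (Function.update w i a) = (∑ w, φ w) * Fintype.card (α i) := by
  have swap : Function.Involutive
      fun p : (∀ i, α i) × α i => (Function.update p.1 i p.2, p.1 i) := fun p => by simp
  calc ∑ w, ∑ a : α i, φ (Function.update w i a)
      = ∑ p : (∀ i, α i) × α i, φ (Function.update p.1 i p.2) :=
        (Fintype.sum_prod_type' fun w a => φ (Function.update w i a)).symm
    _ = ∑ p : (∀ i, α i) × α i, φ p.1 := Equiv.sum_comp swap.toPerm fun p => φ p.1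
    _ = (∑ w, φ w) * Fintype.card (α i) := by
        simp [Fintype.sum_prod_type, mul_comm, Finset.mul_sum]

namespace Code

variable {K : ℕ} {X Y : Fin K → Type*} [∀ i, MeasurableSpace (Y i)] {M : Fin K → ℕ} {N : ℕ}
  (c : Code X Y M N)

/-- The event that the receivers in `J` decode the messages `w`. -/
def correct (J : Finset (Fin K)) (w : ∀ i, Fin (M i)) : Set (Fin N → ∀ i, Y i) :=
  {y | ∀ j ∈ J, c.dec j (fun t => y t j) = w j}

lemma measurable_dec_comp (j : Fin K) :
    Measurable fun y : Fin N → ∀ i, Y i => c.dec j fun t => y t j :=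
  (c.measurable_dec j).comp (by fun_prop)

lemma measurableSet_comap_correct {J : Finset (Fin K)} {s : Set (Fin K)} (hJ : ∀ j ∈ J, j ∈ s)
    (w : ∀ i, Fin (M i)) :
    MeasurableSet[.comap (fun y t => s.domRestrict (y t)) .pi] (c.correct J w) := by
  refine ⟨⋂ j : J, (fun v : Fin N → ∀ l : s, Y l =>
    c.dec j fun t => v t ⟨j, hJ j j.2⟩) ⁻¹' {w j}, .iInter fun j => ?_, ?_⟩
  · exact (c.measurable_dec j).comp (by fun_prop) (measurableSet_singleton _)
  · ext y
    simp [correct]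

lemma measurableSet_correct (J : Finset (Fin K)) (w : ∀ i, Fin (M i)) :
    MeasurableSet (c.correct J w) :=
  Measurable.comap_le (by fun_prop) _
    (c.measurableSet_comap_correct (s := Set.univ) (fun _ _ => trivial) w)

lemma correct_insert_update {J : Finset (Fin K)} {j : Fin K} (hj : j ∉ J) (w : ∀ i, Fin (M i))
    (a : Fin (M j)) :
    c.correct (insert j J) (Function.update w j a) =
      c.correct J w ∩ (fun y => c.dec j fun t => y t j) ⁻¹' {a} := by
  ext y
  have hne : ∀ l ∈ J, l ≠ j := fun l hl h => hj (h ▸ hl)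
  simp only [correct, Finset.forall_mem_insert, Function.update_self, Set.mem_inter_iff,
    Set.mem_ofPred_eq, Set.mem_preimage, Set.mem_singleton_iff]
  rw [and_comm]
  exact and_congr_left' (forall₂_congr fun l hl => by rw [Function.update_of_ne (hne l hl)])

lemma sum_measure_correct_insert_update {J : Finset (Fin K)} {j : Fin K} (hj : j ∉ J)
    (w : ∀ i, Fin (M i)) (μ : Measure (Fin N → ∀ i, Y i)) :
    ∑ a, μ (c.correct (insert j J) (Function.update w j a)) = μ (c.correct J w) := by
  have h := sum_measure_preimage_singleton (μ := μ.restrict (c.correct J w)) Finset.univ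
    fun a _ => c.measurable_dec_comp j (measurableSet_singleton a)
  simp_rw [Measure.restrict_apply (c.measurable_dec_comp j (measurableSet_singleton _))] at h
  simpa [c.correct_insert_update hj, Set.inter_comm] using h

lemma input_update_apply (w : ∀ i, Fin (M i)) {j l : Fin K} (hl : l < j) (a : Fin (M j))
    (t : Fin N) : c.input (Function.update w j a) t l = c.input w t l :=
  congrArg (c.enc l · t) <| funext fun k => Function.update_of_ne (k.2.trans_lt hl).ne _ _

/-- Under causal output laws the outputs up to `j` do not depend on the message of user `j`, so that
every receiver can only guess its message. -/
theorem sum_pi_correct_mul_prod {Q : (∀ i, X i) → Measure (∀ i, Y i)}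
    [∀ x, IsProbabilityMeasure (Q x)] (hQ : IsCausal Q) (J : Finset (Fin K)) :
    (∑ w, Measure.pi (fun t => Q (c.input w t)) (c.correct J w)) * ∏ j ∈ J, (M j : ℝ≥0∞) =
      Fintype.card (∀ i, Fin (M i)) := by
  induction J using Finset.induction_on_max with
  | empty => simp [correct]
  | insert j J hJ ih =>
    have hj : j ∉ J := fun h => (hJ j h).false
    have hlaw : ∀ w a, Measure.pi (fun t => Q (c.input (Function.update w j a) t))
          (c.correct (insert j J) (Function.update w j a)) =
        Measure.pi (fun t => Q (c.input w t))
          (c.correct (insert j J) (Function.update w j a)) := fun w a => by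
      refine pi_apply_eq_of_map_eq (r := fun _ => (Set.Iic j).domRestrict)
        (fun _ => Set.measurable_restrict _)
        (fun t => hQ j _ _ fun l hl => c.input_update_apply w hl a t)
        (c.measurableSet_comap_correct (s := Set.Iic j) (fun l hl => ?_) _)
      rcases Finset.mem_insert.1 hl with rfl | h
      · exact Set.self_mem_Iic
      · exact (hJ l h).le
    calc (∑ w, Measure.pi (fun t => Q (c.input w t)) (c.correct (insert j J) w)) *
          ∏ l ∈ insert j J, (M l : ℝ≥0∞)
        = (∑ w, Measure.pi (fun t => Q (c.input w t)) (c.correct (insert j J) w)) *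
          Fintype.card (Fin (M j)) * ∏ l ∈ J, (M l : ℝ≥0∞) := by
          rw [Finset.prod_insert hj, mul_assoc, Fintype.card_fin]
      _ = (∑ w, Measure.pi (fun t => Q (c.input w t)) (c.correct J w)) *
          ∏ l ∈ J, (M l : ℝ≥0∞) := by
          rw [← sum_sum_update]
          simp only [hlaw, c.sum_measure_correct_insert_update hj]
      _ = Fintype.card (∀ i, Fin (M i)) := ih

lemma prod_mul_sum_measureReal_pi_correct {Q : (∀ i, X i) → Measure (∀ i, Y i)}
    [∀ x, IsProbabilityMeasure (Q x)] (hQ : IsCausal Q) (J : Finset (Fin K)) :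
    (∏ j ∈ J, (M j : ℝ)) * ∑ w, (Measure.pi fun t => Q (c.input w t)).real (c.correct J w) =
      Fintype.card (∀ i, Fin (M i)) := by
  have h := congrArg ENNReal.toReal (c.sum_pi_correct_mul_prod hQ J)
  rw [ENNReal.toReal_mul, ENNReal.toReal_sum fun w _ => measure_ne_top _ _,
    ENNReal.toReal_prod] at h
  simpa [Measure.real, mul_comm] using h

section Converse

variable {K : ℕ} {X Y : Fin K → Type*} [∀ i, MeasurableSpace (X i)] [∀ i, MeasurableSpace (Y i)]
  {M : Fin K → ℕ} {N : ℕ} (c : Code X Y M N) (ch : Kernel (∀ i, X i) (∀ i, Y i)) [IsMarkovKernel ch]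

instance (w : ∀ i, Fin (M i)) : IsProbabilityMeasure (c.outputLaw ch w) := by
  unfold Code.outputLaw
  infer_instance

lemma toReal_userErrorProb (j : Fin K) :
    (c.userErrorProb ch j).toReal =
      (∑ w, (c.outputLaw ch w).real {y | c.dec j (fun t => y t j) ≠ w j}) /
        Fintype.card (∀ i, Fin (M i)) := by
  rw [userErrorProb, ENNReal.toReal_div, ENNReal.toReal_sum fun _ _ => measure_ne_top _ _]
  simp [Measure.real]

lemma one_sub_sum_le_measureReal_correct (J : Finset (Fin K)) (w : ∀ i, Fin (M i)) :
    1 - ∑ j ∈ J, (c.outputLaw ch w).real {y | c.dec j (fun t => y t j) ≠ w j} ≤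
      (c.outputLaw ch w).real (c.correct J w) := by
  have h_compl := probReal_compl_eq_one_sub (μ := c.outputLaw ch w) (c.measurableSet_correct J w)
  have h_subset : (c.correct J w)ᶜ ⊆ ⋃ j ∈ J, {y | c.dec j (fun t => y t j) ≠ w j} := fun y hy => by
    simpa [correct] using hy
  have h_union := (measureReal_mono h_subset (measure_ne_top (c.outputLaw ch w) _)).trans
    (measureReal_biUnion_finset_le J _)
  linarith

lemma card_mul_one_sub_sum_le_sum_measureReal_correct [∀ i, NeZero (M i)] (J : Finset (Fin K)) :
    Fintype.card (∀ i, Fin (M i)) * (1 - ∑ j ∈ J, (c.userErrorProb ch j).toReal) ≤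
      ∑ w, (c.outputLaw ch w).real (c.correct J w) := by
  have hW : (Fintype.card (∀ i, Fin (M i)) : ℝ) ≠ 0 := Nat.cast_ne_zero.2 Fintype.card_ne_zero
  calc Fintype.card (∀ i, Fin (M i)) * (1 - ∑ j ∈ J, (c.userErrorProb ch j).toReal)
      = ∑ w, (1 - ∑ j ∈ J, (c.outputLaw ch w).real {y | c.dec j (fun t => y t j) ≠ w j}) := by
        simp only [toReal_userErrorProb, mul_sub, ← Finset.sum_div, mul_div_cancel₀ _ hW,
          Finset.sum_sub_distrib]
        rw [Finset.sum_comm]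
        simp
    _ ≤ ∑ w, (c.outputLaw ch w).real (c.correct J w) :=
        Finset.sum_le_sum fun w _ => c.one_sub_sum_le_measureReal_correct ch J w

/-- Tests the channel output law against the causal law `Q`, under which the receivers guess. -/
theorem one_sub_mul_sum_log_sub_le [∀ i, NeZero (M i)] {Q : (∀ i, X i) → Measure (∀ i, Y i)}
    [∀ x, IsProbabilityMeasure (Q x)] (hQ : IsCausal Q) {J : Finset (Fin K)}
    {D : (∀ i, X i) → (∀ i, Y i) → ℝ} (hDm : ∀ w t, Measurable (D (c.input w t)))
    (hD : ∀ w t, Integrable (D (c.input w t)) (ch (c.input w t)))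
    (h : ∀ w t, ((ch (c.input w t)).withDensity fun y =>
        .ofReal (Real.exp (-D (c.input w t) y))).map (J : Set (Fin K)).domRestrict ≤
      (Q (c.input w t)).map (J : Set (Fin K)).domRestrict) :
    (1 - ∑ j ∈ J, (c.userErrorProb ch j).toReal) * (∑ j ∈ J, Real.log (M j)) - Real.log 2 ≤
      (∑ w, ∑ t, ∫ y, D (c.input w t) y ∂ch (c.input w t)) / Fintype.card (∀ i, Fin (M i)) := by
  set m : ℝ := ∏ j ∈ J, (M j : ℝ)
  set W : ℝ := (Fintype.card (∀ i, Fin (M i)) : ℝ)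
  have hM : ∀ j, 0 < (M j : ℝ) := fun j => Nat.cast_pos.2 (NeZero.pos (M j))
  have hW : 0 < W := Nat.cast_pos.2 Fintype.card_pos
  have hlogm : Real.log m = ∑ j ∈ J, Real.log (M j) := Real.log_prod fun j _ => (hM j).ne'
  have hlogm_nonneg : 0 ≤ Real.log m :=
    hlogm ▸ Finset.sum_nonneg fun j _ => Real.log_natCast_nonneg _
  have htest : ∀ w, Real.log m * (c.outputLaw ch w).real (c.correct J w) ≤
      ∑ t, ∫ y, D (c.input w t) y ∂ch (c.input w t) +
        (m * (Measure.pi fun t => Q (c.input w t)).real (c.correct J w) - 1) / 2 + Real.log 2 :=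
    fun w => log_mul_measureReal_pi_le_sum_integral_add (hDm w) (hD w)
      (fun _ => Set.measurable_restrict _) (h w) (c.measurableSet_comap_correct (fun _ hj => hj) w)
      (Finset.prod_pos fun j _ => hM j)
  have hsum : Real.log m * ∑ w, (c.outputLaw ch w).real (c.correct J w) ≤
      ∑ w, ∑ t, ∫ y, D (c.input w t) y ∂ch (c.input w t) + W * Real.log 2 := by
    have hguess : m * ∑ w, (Measure.pi fun t => Q (c.input w t)).real (c.correct J w) = W :=
      c.prod_mul_sum_measureReal_pi_correct hQ J
    have := Finset.sum_le_sum fun w (_ : w ∈ Finset.univ) => htest w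
    simpa [Finset.sum_add_distrib, ← Finset.sum_div, ← Finset.mul_sum, hguess, W] using this
  have hcorrect := mul_le_mul_of_nonneg_left
    (c.card_mul_one_sub_sum_le_sum_measureReal_correct ch J) hlogm_nonneg
  rw [le_div_iff₀ hW, ← hlogm]
  linarith

end Converse
end Code

section NumMessages

variable {N : ℕ} {r : ℝ}

lemma numMessages_pos (hr : 0 ≤ r) : 0 < numMessages N r :=
  Nat.floor_pos.2 (Real.one_le_rpow one_le_two (by positivity))

lemma log_numMessages_le (hr : 0 ≤ r) : Real.log (numMessages N r) ≤ N * r * Real.log 2 := by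
  have h := Real.log_le_log (Nat.cast_pos.2 (numMessages_pos (N := N) hr))
    (Nat.floor_le (Real.rpow_nonneg zero_le_two ((N : ℝ) * r)))
  rwa [Real.log_rpow two_pos] at h

lemma sub_one_mul_log_two_le_log_numMessages (hr : 0 ≤ r) :
    (N * r - 1) * Real.log 2 ≤ Real.log (numMessages N r) := by
  have h_one : (1 : ℝ) ≤ numMessages N r := Nat.one_le_cast.2 (numMessages_pos hr)
  have h_lt : (2 : ℝ) ^ ((N : ℝ) * r) < numMessages N r + 1 := Nat.lt_floor_add_one _
  have h := Real.log_le_log (by positivity)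
    (h_lt.le.trans (by linarith : (numMessages N r + 1 : ℝ) ≤ 2 * numMessages N r))
  rw [Real.log_rpow two_pos, Real.log_mul two_ne_zero (by linarith)] at h
  linarith

end NumMessages

namespace Code

section ErrorProbability

variable {K : ℕ} {X Y : Fin K → Type*} [∀ i, MeasurableSpace (X i)] [∀ i, MeasurableSpace (Y i)]
  {M : Fin K → ℕ} {N : ℕ} (c : Code X Y M N)

lemma userErrorProb_congr {ch ch' : Kernel (∀ i, X i) (∀ i, Y i)} [IsMarkovKernel ch]
    [IsMarkovKernel ch'] (h : SameMarginals ch ch') (i : Fin K) :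
    c.userErrorProb ch' i = c.userErrorProb ch i := by
  have hmarginal : ∀ x, (ch' x).map (fun y => y i) = (ch x).map (fun y => y i) := fun x => by
    rw [← Kernel.map_apply _ (measurable_pi_apply i), h i,
      Kernel.map_apply _ (measurable_pi_apply i)]
  simp only [userErrorProb, outputLaw]
  congr 1
  refine Finset.sum_congr rfl fun w _ => pi_apply_eq_of_map_eq
    (fun _ => measurable_pi_apply i) (fun t => hmarginal (c.input w t)) ?_
  exact ⟨_, c.measurable_dec i (measurableSet_singleton (w i)).compl, rfl⟩

/-- The rate that the converse loses at finite block length, through the decoding errors and the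
rounding of the numbers of messages. -/
noncomputable def rateLoss (ch : Kernel (∀ i, X i) (∀ i, Y i)) (R : Fin K → ℝ) : ℝ :=
  (∑ i, (c.userErrorProb ch i).toReal) * ∑ i, R i + (K + 1) / N

variable {ch : Kernel (∀ i, X i) (∀ i, Y i)} {R : Fin K → ℝ}

lemma rateLoss_nonneg (hR : ∀ i, 0 ≤ R i) : 0 ≤ c.rateLoss ch R := by
  have := Finset.sum_nonneg fun i (_ : i ∈ Finset.univ) => hR i
  unfold rateLoss
  positivity

end ErrorProbability

section Rates

variable {K : ℕ} {X Y : Fin K → Type*} [∀ i, MeasurableSpace (X i)] [∀ i, MeasurableSpace (Y i)]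
  {ch : Kernel (∀ i, X i) (∀ i, Y i)} {R : Fin K → ℝ}

lemma tendsto_rateLoss {c : ∀ N, Code X Y (fun i => numMessages N (R i)) N}
    (hc : Tendsto (fun N => (c N).errorProb ch) atTop (𝓝 0)) :
    Tendsto (fun N => (c N).rateLoss ch R) atTop (𝓝 0) := by
  have herr : ∀ i, Tendsto (fun N => ((c N).userErrorProb ch i).toReal) atTop (𝓝 0) := fun i =>
    (ENNReal.tendsto_toReal ENNReal.zero_ne_top).comp <|
      tendsto_of_tendsto_of_tendsto_of_le_of_le tendsto_const_nhds hc (fun _ => zero_le)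
        fun N => le_iSup (fun i => (c N).userErrorProb ch i) i
  simpa [rateLoss] using ((tendsto_finsetSum Finset.univ fun i _ => herr i).mul_const
    (∑ i, R i)).add (tendsto_const_div_atTop_nhds_zero_nat ((K : ℝ) + 1))

lemma sum_sub_rateLoss_mul_le {N : ℕ} [NeZero N]
    (c : Code X Y (fun i => numMessages N (R i)) N) (hR : ∀ i, 0 ≤ R i) (J : Finset (Fin K)) :
    (∑ j ∈ J, R j - c.rateLoss ch R) * (N * Real.log 2) ≤
      (1 - ∑ j ∈ J, (c.userErrorProb ch j).toReal) *
        (∑ j ∈ J, Real.log (numMessages N (R j))) - Real.log 2 := by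
  have : 0 < Real.log 2 := Real.log_pos one_lt_two
  have hN : (N : ℝ) ≠ 0 := Nat.cast_ne_zero.2 (NeZero.ne N)
  set err := ∑ i, (c.userErrorProb ch i).toReal
  set S := ∑ i, R i
  set logs := ∑ j ∈ J, Real.log (numMessages N (R j))
  have hlogs_nonneg : 0 ≤ logs := Finset.sum_nonneg fun j _ => Real.log_natCast_nonneg _
  have hcard : (J.card : ℝ) ≤ K := by
    exact_mod_cast (Finset.card_le_univ J).trans_eq (Fintype.card_fin K)
  have hlogs_ge : (N * ∑ j ∈ J, R j - K) * Real.log 2 ≤ logs :=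
    calc (N * ∑ j ∈ J, R j - K) * Real.log 2
        ≤ (N * ∑ j ∈ J, R j - J.card) * Real.log 2 := by gcongr
      _ = ∑ j ∈ J, (N * R j - 1) * Real.log 2 := by
          rw [← Finset.sum_mul, Finset.sum_sub_distrib, ← Finset.mul_sum]
          simp
      _ ≤ logs := Finset.sum_le_sum fun j _ => sub_one_mul_log_two_le_log_numMessages (hR j)
  have hlogs_le : logs ≤ N * S * Real.log 2 :=
    calc logs ≤ ∑ j, Real.log (numMessages N (R j)) :=
          Finset.sum_le_univ_sum_of_nonneg fun _ => Real.log_natCast_nonneg _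
      _ ≤ ∑ j, N * R j * Real.log 2 := Finset.sum_le_sum fun j _ => log_numMessages_le (hR j)
      _ = N * S * Real.log 2 := by rw [← Finset.sum_mul, ← Finset.mul_sum]
  have herr : (∑ j ∈ J, (c.userErrorProb ch j).toReal) * logs ≤ err * (N * S * Real.log 2) :=
    mul_le_mul (Finset.sum_le_univ_sum_of_nonneg fun _ => ENNReal.toReal_nonneg) hlogs_le
      hlogs_nonneg (Finset.sum_nonneg fun _ _ => ENNReal.toReal_nonneg)
  have hloss : c.rateLoss ch R * (N * Real.log 2) =
      err * (N * S * Real.log 2) + (K + 1) * Real.log 2 := by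
    unfold rateLoss
    field_simp
    ring
  linarith

end Rates

section InputLaw

variable {K : ℕ} {X Y : Fin K → Type*} [∀ i, MeasurableSpace (X i)] [∀ i, MeasurableSpace (Y i)]
  {M : Fin K → ℕ} {N : ℕ} (c : Code X Y M N)

/-- The law of the channel input at a uniformly random time for uniformly random messages. -/
noncomputable def inputLaw : Measure (∀ i, X i) :=
  (Fintype.card (∀ i, Fin (M i)) * N : ℝ≥0∞)⁻¹ • ∑ w, ∑ t, Measure.dirac (c.input w t)

instance [∀ i, NeZero (M i)] [NeZero N] : IsProbabilityMeasure c.inputLaw := by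
  refine ⟨?_⟩
  have hN : (N : ℝ≥0∞) ≠ 0 := Nat.cast_ne_zero.2 (NeZero.ne N)
  have hW : (Fintype.card (∀ i, Fin (M i)) : ℝ≥0∞) ≠ 0 := Nat.cast_ne_zero.2 Fintype.card_ne_zero
  have h : (Fintype.card (∀ i, Fin (M i)) * N : ℝ≥0∞)⁻¹ *
      (Fintype.card (∀ i, Fin (M i)) * N) = 1 :=
    ENNReal.inv_mul_cancel (mul_ne_zero hW hN) (by finiteness)
  simpa [inputLaw] using h

variable [∀ i, MeasurableSingletonClass (X i)]

lemma inputLaw_singleton_ne_zero (w : ∀ i, Fin (M i)) (t : Fin N) :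
    c.inputLaw {c.input w t} ≠ 0 := by
  have hfin : (Fintype.card (∀ i, Fin (M i)) * N : ℝ≥0∞) ≠ ∞ := by finiteness
  simp only [inputLaw, Measure.smul_apply, Measure.finsetSum_apply, smul_eq_mul, ne_eq,
    mul_eq_zero, ENNReal.inv_eq_zero, hfin, false_or, Finset.sum_eq_zero_iff]
  exact fun h => by simpa using h w (Finset.mem_univ _) t (Finset.mem_univ _)

lemma integral_inputLaw (f : (∀ i, X i) → ℝ) :
    ∫ x, f x ∂c.inputLaw =
      (∑ w, ∑ t, f (c.input w t)) / (Fintype.card (∀ i, Fin (M i)) * N) := by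
  have hint : ∀ x, Integrable f (Measure.dirac x) := fun x => integrable_dirac (by finiteness)
  rw [inputLaw, integral_smul_measure, integral_finsetSum_measure fun w _ =>
    integrable_finsetSum_measure.2 fun t _ => hint _]
  simp_rw [integral_finsetSum_measure fun _ _ => hint _, integral_dirac]
  simp [div_eq_inv_mul, mul_comm]

end InputLaw

section Converse

variable {K : ℕ} {X Y : Fin K → Type*} [∀ i, MeasurableSpace (X i)] [∀ i, MeasurableSpace (Y i)]
  [∀ i, MeasurableSingletonClass (X i)] [∀ i, Nonempty (Y i)] {N : ℕ} {R : Fin K → ℝ}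

theorem log_two_mul_sub_rateLoss_le_integral_inputLaw [NeZero N]
    (c : Code X Y (fun i => numMessages N (R i)) N) (hR : ∀ i, 0 ≤ R i)
    {ch ch' : Kernel (∀ i, X i) (∀ i, Y i)} [IsMarkovKernel ch] [IsMarkovKernel ch']
    (hch : SameMarginals ch ch') {J : Finset (Fin K)} {s : Fin K → Set (Fin K)}
    (hs : ∀ j ∈ J, s j = {l | l ∈ J ∧ l < j}) {A : Set (∀ i, X i)} (hA : ∀ w t, c.input w t ∈ A)
    {ℓ : ∀ j, (∀ i, X i) → (∀ l : s j, Y l) × Y j → ℝ}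
    {q : ∀ j, Kernel ((∀ l : Set.Iio j, X l) × ∀ l : s j, Y l) (Y j)}
    (h : ∀ j ∈ J, IsCausalBound ch' A (s j) j (ℓ j) (q j)) :
    Real.log 2 * (∑ j ∈ J, R j - c.rateLoss ch R) ≤
      ∫ x, ∑ j ∈ J, condMean ch' (s j) j (ℓ j) x ∂c.inputLaw := by
  have : ∀ i, NeZero (numMessages N (R i)) := fun i => ⟨(numMessages_pos (hR i)).ne'⟩
  obtain ⟨Q, hQ_prob, hQ, hQ_le⟩ := exists_isCausal_lintegral_le hs h
  have hint : ∀ w t, ∀ j ∈ J, Integrable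
      (fun y => ℓ j (c.input w t) ((s j).domRestrict y, y j)) (ch' (c.input w t)) :=
    fun w t j hj => (h j hj).integrable _ (hA w t)
  have hconverse := c.one_sub_mul_sum_log_sub_le ch' hQ (J := J)
    (D := fun x y => ∑ j ∈ J, ℓ j x ((s j).domRestrict y, y j))
    (fun w t => Finset.measurable_sum _ fun j hj =>
      ((h j hj).measurable _ (hA w t)).comp (by fun_prop))
    (fun w t => integrable_finsetSum _ (hint w t))
    (fun w t => ?_)
  · simp only [c.userErrorProb_congr hch, integral_finsetSum _ (hint _ _)] at hconverse
    have hN : (0 : ℝ) < N := Nat.cast_pos.2 (NeZero.pos N)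
    have hrate := (c.sum_sub_rateLoss_mul_le (ch := ch) hR J).trans hconverse
    rw [c.integral_inputLaw, ← div_div, le_div_iff₀ hN]
    refine le_trans (le_of_eq ?_) hrate
    ring
  · exact map_withDensity_le_map (Set.measurable_restrict _) fun F hF =>
      hQ_le _ (hA w t) J subset_rfl F hF

end Converse
end Code

section InformationDensity

lemma lintegral_mul_exp_neg_llr_le {α : Type*} [MeasurableSpace α] {ρ ν : Measure α}
    [IsFiniteMeasure ρ] [IsFiniteMeasure ν] (hρν : ρ ≪ ν) {F : α → ℝ≥0∞} (hF : Measurable F) :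
    ∫⁻ z, F z * .ofReal (Real.exp (-llr ρ ν z)) ∂ρ ≤ ∫⁻ z, F z ∂ν :=
  calc ∫⁻ z, F z * .ofReal (Real.exp (-llr ρ ν z)) ∂ρ
      = ∫⁻ z, ν.rnDeriv ρ z * F z ∂ρ := by
        refine lintegral_congr_ae ?_
        filter_upwards [exp_neg_llr hρν, ν.rnDeriv_lt_top ρ] with z hz hz_top
        rw [hz, ENNReal.ofReal_toReal hz_top.ne, mul_comm]
    _ = ∫⁻ z, F z ∂ρ.withDensity (ν.rnDeriv ρ) :=
        (lintegral_withDensity_eq_lintegral_mul _ (Measure.measurable_rnDeriv _ _) hF).symm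
    _ ≤ ∫⁻ z, F z ∂ν := lintegral_mono' (Measure.withDensity_rnDeriv_le _ _) le_rfl

variable {Ω α β γ : Type*} [MeasurableSpace Ω]
  [MeasurableSpace α] [StandardBorelSpace α] [Nonempty α] [MeasurableSpace γ]

lemma lintegral_lintegral_condDistrib (μ : Measure Ω) [IsFiniteMeasure μ] {A : Ω → α} {C : Ω → γ}
    (hA : Measurable A) (hC : Measurable C) {F : γ × α → ℝ≥0∞} (hF : Measurable F) :
    ∫⁻ ω, ∫⁻ a, F (C ω, a) ∂condDistrib A C μ (C ω) ∂μ = ∫⁻ ω, F (C ω, A ω) ∂μ := by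
  rw [← lintegral_map hF (hC.prodMk hA), ← compProd_map_condDistrib hA.aemeasurable,
    Measure.lintegral_compProd hF, lintegral_map hF.lintegral_kernel_prod_right' hC]

variable [MeasurableSpace β] [StandardBorelSpace β] [Nonempty β]

lemma lintegral_compProd_condDistrib_prod (μ : Measure Ω) [IsFiniteMeasure μ] (A : Ω → α)
    {B : Ω → β} {C : Ω → γ} (hB : Measurable B) (hC : Measurable C) {F : γ × α × β → ℝ≥0∞}
    (hF : Measurable F) :
    ∫⁻ z, F z ∂(μ.map C ⊗ₘ (condDistrib A C μ ×ₖ condDistrib B C μ)) =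
      ∫⁻ ω, ∫⁻ a, F (C ω, a, B ω) ∂condDistrib A C μ (C ω) ∂μ := by
  have hG : Measurable fun p : γ × β => ∫⁻ a, F (p.1, a, p.2) ∂condDistrib A C μ p.1 :=
    Measurable.lintegral_kernel_prod_right'
      (κ := (condDistrib A C μ).comap (Prod.fst : γ × β → γ) measurable_fst)
      (f := fun p : (γ × β) × α => F (p.1.1, p.2, p.1.2)) (by fun_prop)
  calc ∫⁻ z, F z ∂(μ.map C ⊗ₘ (condDistrib A C μ ×ₖ condDistrib B C μ))
      = ∫⁻ ω, ∫⁻ b, ∫⁻ a, F (C ω, a, b) ∂condDistrib A C μ (C ω) ∂condDistrib B C μ (C ω) ∂μ := by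
        rw [Measure.lintegral_compProd hF, lintegral_map hF.lintegral_kernel_prod_right' hC]
        refine lintegral_congr fun ω => ?_
        rw [Kernel.prod_apply, lintegral_prod_symm' _ (by fun_prop)]
    _ = ∫⁻ ω, ∫⁻ a, F (C ω, a, B ω) ∂condDistrib A C μ (C ω) ∂μ :=
        lintegral_lintegral_condDistrib μ hB hC hG

lemma exists_information_density (μ : Measure Ω) [IsProbabilityMeasure μ] {A : Ω → α} {B : Ω → β}
    {C : Ω → γ} (hA : Measurable A) (hB : Measurable B) (hC : Measurable C)
    (hI : condMutualInfo μ A B C ≠ ∞) :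
    ∃ i : γ × α × β → ℝ, Measurable i ∧ Integrable (fun ω => i (C ω, A ω, B ω)) μ ∧
      ∫ ω, i (C ω, A ω, B ω) ∂μ = Real.log 2 * (condMutualInfo μ A B C).toReal ∧
      ∀ F : γ × α × β → ℝ≥0∞, Measurable F →
        ∫⁻ ω, F (C ω, A ω, B ω) * .ofReal (Real.exp (-i (C ω, A ω, B ω))) ∂μ ≤
          ∫⁻ ω, ∫⁻ a, F (C ω, a, B ω) ∂condDistrib A C μ (C ω) ∂μ := by
  have hCAB : Measurable fun ω => (C ω, A ω, B ω) := hC.prodMk (hA.prodMk hB)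
  have hlog2 : 0 < Real.log 2 := Real.log_pos one_lt_two
  set ρ := μ.map fun ω => (C ω, A ω, B ω)
  set ν := μ.map C ⊗ₘ (condDistrib A C μ ×ₖ condDistrib B C μ)
  have : IsProbabilityMeasure ρ := Measure.isProbabilityMeasure_map hCAB.aemeasurable
  have : IsProbabilityMeasure (μ.map C) := Measure.isProbabilityMeasure_map hC.aemeasurable
  have hI_eq : condMutualInfo μ A B C =
      InformationTheory.klDiv ρ ν / ENNReal.ofReal (Real.log 2) := rfl
  have hkl : InformationTheory.klDiv ρ ν ≠ ∞ := fun h => hI (by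
    rw [hI_eq, h, ENNReal.top_div_of_ne_top ENNReal.ofReal_ne_top])
  obtain ⟨hρν, hint⟩ := InformationTheory.klDiv_ne_top_iff.1 hkl
  have hllr : Measurable (llr ρ ν) := measurable_llr _ _
  refine ⟨llr ρ ν, hllr,
    (integrable_map_measure hllr.aestronglyMeasurable hCAB.aemeasurable).1 hint, ?_,
    fun F hF => ?_⟩
  · rw [hI_eq, ENNReal.toReal_div, ENNReal.toReal_ofReal hlog2.le, mul_div_cancel₀ _ hlog2.ne',
      InformationTheory.toReal_klDiv_of_measure_eq hρν (by simp),
      integral_map hCAB.aemeasurable hllr.aestronglyMeasurable]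
  · rw [← lintegral_map (f := fun z => F z * .ofReal (Real.exp (-llr ρ ν z))) (by fun_prop) hCAB,
      ← lintegral_compProd_condDistrib_prod μ A hB hC hF]
    exact lintegral_mul_exp_neg_llr_le hρν hF

end InformationDensity

section Atoms

variable {α β : Type*} [MeasurableSpace α] {P : Measure α}

lemma of_ae_of_singleton_ne_zero {p : α → Prop} (h : ∀ᵐ x ∂P, p x) {x : α} (hx : P {x} ≠ 0) :
    p x := by
  by_contra hp
  exact hx (measure_mono_null (by simpa using hp) (ae_iff.1 h))

lemma lintegral_compProd_indicator_fst_singleton [MeasurableSingletonClass α] [MeasurableSpace β]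
    [SFinite P] (κ : Kernel α β) [IsSFiniteKernel κ] (x : α) {F : α × β → ℝ≥0∞}
    (hF : Measurable F) :
    ∫⁻ z, (Prod.fst ⁻¹' {x}).indicator F z ∂(P ⊗ₘ κ) = P {x} * ∫⁻ y, F (x, y) ∂κ x := by
  have hx := measurableSet_singleton x
  rw [lintegral_indicator (measurable_fst hx), ← Set.prod_univ,
    Measure.setLIntegral_compProd hF hx .univ, lintegral_singleton, setLIntegral_univ, mul_comm]

lemma lintegral_le_lintegral_of_indicator_fst_singleton [MeasurableSingletonClass α]
    [MeasurableSpace β] [IsFiniteMeasure P] {κ : Kernel α β} [IsSFiniteKernel κ] {x : α}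
    (hx : P {x} ≠ 0) {F G : α × β → ℝ≥0∞} (hF : Measurable F) (hG : Measurable G)
    (h : ∫⁻ z, (Prod.fst ⁻¹' {x}).indicator F z ∂(P ⊗ₘ κ) ≤
      ∫⁻ z, (Prod.fst ⁻¹' {x}).indicator G z ∂(P ⊗ₘ κ)) :
    ∫⁻ y, F (x, y) ∂κ x ≤ ∫⁻ y, G (x, y) ∂κ x := by
  rw [lintegral_compProd_indicator_fst_singleton κ x hF,
    lintegral_compProd_indicator_fst_singleton κ x hG] at h
  exact (ENNReal.mul_le_mul_iff_right hx (measure_ne_top _ _)).1 h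

end Atoms

section CausalInformation

variable {ι : Type*} [LinearOrder ι] {X Y : ι → Type*} [∀ i, MeasurableSpace (X i)]
  [∀ i, MeasurableSpace (Y i)]

/-- `r` bits are the mean, for the input law `P`, of a log-likelihood ratio of the outputs
`(Y_s, Y_j)` that is causally bounded on the atoms of `P`. -/
def IsCausalInformation (P : Measure (∀ i, X i)) (ch : Kernel (∀ i, X i) (∀ i, Y i)) (s : Set ι)
    (j : ι) (r : ℝ) : Prop :=
  ∃ ℓ q, IsCausalBound ch {x | P {x} ≠ 0} s j ℓ q ∧ Integrable (condMean ch s j ℓ) P ∧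
    ∫ x, condMean ch s j ℓ x ∂P = Real.log 2 * r

lemma IsCausalBound.isCausalInformation {P : Measure (∀ i, X i)} [SFinite P]
    {ch : Kernel (∀ i, X i) (∀ i, Y i)} [IsSFiniteKernel ch] {s : Set ι} {j : ι} {r : ℝ}
    {ℓ : (∀ i, X i) → (∀ l : s, Y l) × Y j → ℝ}
    {q : Kernel ((∀ l : Set.Iio j, X l) × ∀ l : s, Y l) (Y j)}
    (h : IsCausalBound ch {x | P {x} ≠ 0} s j ℓ q)
    (hint : Integrable (fun z => ℓ z.1 (s.domRestrict z.2, z.2 j)) (P ⊗ₘ ch))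
    (hmean : ∫ z, ℓ z.1 (s.domRestrict z.2, z.2 j) ∂(P ⊗ₘ ch) = Real.log 2 * r) :
    IsCausalInformation P ch s j r :=
  ⟨ℓ, q, h, Integrable.integral_compProd hint,
    by rw [← hmean, Measure.integral_compProd hint]; rfl⟩

lemma exists_measurable_domRestrict_Iio_Ici (j : ι) :
    ∃ g : (∀ l : Set.Iio j, X l) × (∀ l : Set.Ici j, X l) → ∀ i, X i, Measurable g ∧
      ∀ x, g ((Set.Iio j).domRestrict x, (Set.Ici j).domRestrict x) = x := by
  refine ⟨fun p l => if hl : l < j then p.1 ⟨l, hl⟩ else p.2 ⟨l, not_lt.1 hl⟩,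
    measurable_pi_lambda _ fun l => ?_, fun x => funext fun l => by simp⟩
  by_cases hl : l < j
  · simp only [hl, dite_true]
    fun_prop
  · simp only [hl, dite_false]
    fun_prop

lemma isCausalBound_of_lintegral_compProd_le [Countable ι] [∀ i, MeasurableSingletonClass (X i)]
    {P : Measure (∀ i, X i)} [IsFiniteMeasure P]
    {ch : Kernel (∀ i, X i) (∀ i, Y i)} [IsSFiniteKernel ch] {s : Set ι} {j : ι}
    {ℓ : (∀ i, X i) × (∀ l : s, Y l) × Y j → ℝ}
    {q : Kernel ((∀ l : Set.Iio j, X l) × ∀ l : s, Y l) (Y j)} [IsMarkovKernel q]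
    (hℓ : Measurable ℓ)
    (hint : Integrable (fun z => ℓ (z.1, s.domRestrict z.2, z.2 j)) (P ⊗ₘ ch))
    (hle : ∀ F : (∀ i, X i) × (∀ l : s, Y l) × Y j → ℝ≥0∞, Measurable F →
      ∫⁻ z, F (z.1, s.domRestrict z.2, z.2 j) *
          .ofReal (Real.exp (-ℓ (z.1, s.domRestrict z.2, z.2 j))) ∂(P ⊗ₘ ch) ≤
        ∫⁻ z, ∫⁻ a, F (z.1, s.domRestrict z.2, a)
          ∂q ((Set.Iio j).domRestrict z.1, s.domRestrict z.2) ∂(P ⊗ₘ ch)) :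
    IsCausalBound ch {x | P {x} ≠ 0} s j (fun x p => ℓ (x, p)) q := by
  have hint_ae := ((Measure.integrable_compProd_iff hint.aestronglyMeasurable).1 hint).1
  refine ⟨inferInstance, fun x _ => by fun_prop,
    fun x hx => of_ae_of_singleton_ne_zero hint_ae hx, fun x hx F hF => ?_⟩
  refine lintegral_le_lintegral_of_indicator_fst_singleton hx
    (F := fun z => F (s.domRestrict z.2, z.2 j) *
      .ofReal (Real.exp (-ℓ (z.1, s.domRestrict z.2, z.2 j))))
    (G := fun z => ∫⁻ a, F (s.domRestrict z.2, a)
      ∂q ((Set.Iio j).domRestrict z.1, s.domRestrict z.2)) (by fun_prop) ?_ ?_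
  · exact Measurable.lintegral_kernel_prod_right'
      (κ := q.comap (fun z : (∀ i, X i) × (∀ i, Y i) =>
        ((Set.Iio j).domRestrict z.1, s.domRestrict z.2)) (by fun_prop))
      (f := fun p => F (s.domRestrict p.1.2, p.2)) (by fun_prop)
  · have h := hle ((Prod.fst ⁻¹' {x}).indicator fun p => F p.2)
      ((by fun_prop : Measurable fun p : (∀ i, X i) × (∀ l : s, Y l) × Y j => F p.2).indicator
        (measurable_fst (measurableSet_singleton x)))
    convert h using 3 with z z
    · by_cases hz : z.1 = x <;> simp [hz]
    · by_cases hz : z.1 = x <;> simp [hz]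

variable [Countable ι] [∀ i, StandardBorelSpace (X i)] [∀ i, Nonempty (X i)]
  [∀ i, StandardBorelSpace (Y i)] [∀ i, Nonempty (Y i)]

theorem isCausalInformation_toReal_condMutualInfo (P : Measure (∀ i, X i)) [IsProbabilityMeasure P]
    (ch : Kernel (∀ i, X i) (∀ i, Y i)) [IsMarkovKernel ch] {s : Set ι} {j : ι} {γ : Type*}
    [MeasurableSpace γ] (e : γ ≃ᵐ (∀ l : Set.Iio j, X l) × ∀ l : s, Y l)
    {C : (∀ i, X i) × (∀ i, Y i) → γ}
    (hC : ∀ z, e (C z) = ((Set.Iio j).domRestrict z.1, s.domRestrict z.2))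
    (hI : condMutualInfo (P ⊗ₘ ch) (fun z => z.2 j) (fun z => (Set.Ici j).domRestrict z.1) C ≠ ∞) :
    IsCausalInformation P ch s j (condMutualInfo (P ⊗ₘ ch) (fun z => z.2 j)
      (fun z => (Set.Ici j).domRestrict z.1) C).toReal := by
  have he := e.symm.measurable
  have hC_symm : ∀ z, e.symm ((Set.Iio j).domRestrict z.1, s.domRestrict z.2) = C z := fun z => by
    rw [← hC, e.symm_apply_apply]
  have hC_meas : Measurable C := by
    rw [← funext hC_symm]
    fun_prop
  obtain ⟨i, hi, hi_int, hi_mean, hi_le⟩ :=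
    exists_information_density (P ⊗ₘ ch) (by fun_prop) (by fun_prop) hC_meas hI
  obtain ⟨g, hg, hg_apply⟩ := exists_measurable_domRestrict_Iio_Ici (X := X) j
  refine (isCausalBound_of_lintegral_compProd_le
    (ℓ := fun p => i (e.symm ((Set.Iio j).domRestrict p.1, p.2.1), p.2.2,
      (Set.Ici j).domRestrict p.1))
    (q := (condDistrib (fun z => z.2 j) C (P ⊗ₘ ch)).comap e.symm he)
    (by fun_prop) (by simpa only [hC_symm] using hi_int) fun F hF => ?_).isCausalInformation
    (by simpa only [hC_symm] using hi_int) (by simpa only [hC_symm] using hi_mean)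
  have h := hi_le (fun p => F (g ((e p.1).1, p.2.2), (e p.1).2, p.2.1)) (by fun_prop)
  simpa only [hC, hg_apply, hC_symm, Kernel.comap_apply] using h

end CausalInformation

section Bounds

variable {K : ℕ} {X Y : Fin K → Type*} [∀ i, MeasurableSpace (X i)] [∀ i, MeasurableSpace (Y i)]
  [∀ i, StandardBorelSpace (X i)] [∀ i, Nonempty (X i)]
  [∀ i, StandardBorelSpace (Y i)] [∀ i, Nonempty (Y i)]
  (P : Measure (∀ i, X i)) [IsProbabilityMeasure P]
  (ch : Kernel (∀ i, X i) (∀ i, Y i)) [IsMarkovKernel ch]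

lemma isCausalInformation_toReal_progressiveTerm {i j : Fin K} (h : progressiveTerm P ch i j ≠ ∞) :
    IsCausalInformation P ch (Set.Ico i j) j (progressiveTerm P ch i j).toReal :=
  isCausalInformation_toReal_condMutualInfo P ch (.refl _) (fun _ => rfl) h

lemma isCausalInformation_toReal_singleBound {i : Fin K} (h : singleBound P ch i ≠ ∞) :
    IsCausalInformation P ch ∅ i (singleBound P ch i).toReal :=
  isCausalInformation_toReal_condMutualInfo P ch
    (MeasurableEquiv.prodPUnit.{_, 0}.symm.trans <|
      .prodCongr (.refl _) (.ofUniqueOfUnique PUnit.{1} (∀ l : (∅ : Set (Fin K)), Y l)))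
    (fun _ => Prod.ext rfl (Subsingleton.elim _ _)) h

end Bounds

lemma exists_isMarkovKernel_smul_le {ι α β : Type*} [Fintype ι] [MeasurableSpace α]
    [MeasurableSpace β] {p : ι → ℝ≥0∞} (hp : ∑ i, p i = 1) (κ : ι → Kernel α β)
    [∀ i, IsMarkovKernel (κ i)] :
    ∃ q : Kernel α β, IsMarkovKernel q ∧ ∀ i a, p i • κ i a ≤ q a := by
  refine ⟨⟨fun a => ∑ i, p i • κ i a, Finset.measurable_sum _ fun i _ =>
    (Measure.measurable_of_measurable_coe _ fun s hs => by
      simpa using ((κ i).measurable_coe hs).const_mul (p i))⟩, ⟨fun a => ⟨?_⟩⟩, fun i a => ?_⟩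
  · simp [hp]
  · exact Finset.single_le_sum (f := fun i => p i • κ i a) (fun _ _ => Measure.zero_le _)
      (Finset.mem_univ i)

section Extension

variable {ι : Type*} [LinearOrder ι] {X Y : ι → Type*} [∀ i, MeasurableSpace (X i)]
  [∀ i, MeasurableSpace (Y i)] {ch : Kernel (∀ i, X i) (∀ i, Y i)} {s : Set ι} {j : ι}
  {A : Set (∀ i, X i)} {ℓ : (∀ i, X i) → (∀ l : s, Y l) × Y j → ℝ}
  {q : Kernel ((∀ l : Set.Iio j, X l) × ∀ l : s, Y l) (Y j)}

lemma isCausalBound_condDistrib [StandardBorelSpace (Y j)] [Nonempty (Y j)] [IsFiniteKernel ch]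
    (x : ∀ i, X i) :
    IsCausalBound ch {x} s j 0 ((condDistrib (fun y => y j) s.domRestrict (ch x)).comap Prod.snd
      measurable_snd) := by
  refine ⟨inferInstance, fun _ _ => measurable_const, fun _ _ => integrable_zero _ _ _, ?_⟩
  rintro _ rfl F hF
  simpa [Kernel.comap_apply] using (lintegral_lintegral_condDistrib (ch _)
    (measurable_pi_apply j) (Set.measurable_restrict s) hF).ge

lemma IsCausalBound.sub_log [IsFiniteKernel ch] (h : IsCausalBound ch A s j ℓ q) {c : ℝ}
    (hc : 0 < c) {q' : Kernel ((∀ l : Set.Iio j, X l) × ∀ l : s, Y l) (Y j)} [IsMarkovKernel q']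
    (hq : ∀ p, ENNReal.ofReal c • q p ≤ q' p) :
    IsCausalBound ch A s j (fun x p => ℓ x p - Real.log c) q' := by
  refine ⟨inferInstance, fun x hx => (h.measurable x hx).sub_const _,
    fun x hx => (h.integrable x hx).sub (integrable_const _), fun x hx F hF => ?_⟩
  have hℓ := h.measurable x hx
  have := h.isMarkovKernel
  have hexp : ∀ r : ℝ, ENNReal.ofReal (Real.exp (-(r - Real.log c))) =
      ENNReal.ofReal c * ENNReal.ofReal (Real.exp (-r)) := fun r => by
    rw [← ENNReal.ofReal_mul hc.le, neg_sub, sub_eq_add_neg, Real.exp_add, Real.exp_log hc]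
  calc ∫⁻ y, F (s.domRestrict y, y j) *
        .ofReal (Real.exp (-(ℓ x (s.domRestrict y, y j) - Real.log c))) ∂ch x
      = ENNReal.ofReal c * ∫⁻ y, F (s.domRestrict y, y j) *
          .ofReal (Real.exp (-ℓ x (s.domRestrict y, y j))) ∂ch x := by
        simp only [hexp, mul_left_comm (F _)]
        rw [lintegral_const_mul _ (by fun_prop)]
    _ ≤ ENNReal.ofReal c * ∫⁻ y, ∫⁻ a, F (s.domRestrict y, a)
          ∂q ((Set.Iio j).domRestrict x, s.domRestrict y) ∂ch x :=
        mul_le_mul_right (h.lintegral_le x hx F hF) _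
    _ = ∫⁻ y, ∫⁻ a, F (s.domRestrict y, a)
          ∂(ENNReal.ofReal c • q ((Set.Iio j).domRestrict x, s.domRestrict y)) ∂ch x := by
        simp only [lintegral_smul_measure, smul_eq_mul]
        rw [lintegral_const_mul' _ _ ENNReal.ofReal_ne_top]
    _ ≤ _ := lintegral_mono fun y => lintegral_mono' (hq _) le_rfl

open scoped Classical in
lemma IsCausalBound.piecewise (h : IsCausalBound ch A s j ℓ q)
    {ℓ' : (∀ i, X i) → (∀ l : s, Y l) × Y j → ℝ} (h' : ∀ x, IsCausalBound ch {x} s j ℓ' q) :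
    IsCausalBound ch Set.univ s j (A.piecewise ℓ ℓ') q where
  isMarkovKernel := h.isMarkovKernel
  measurable x _ := by
    by_cases hx : x ∈ A
    · simpa [hx] using h.measurable x hx
    · simpa [hx] using (h' x).measurable x rfl
  integrable x _ := by
    by_cases hx : x ∈ A
    · simpa [hx] using h.integrable x hx
    · simpa [hx] using (h' x).integrable x rfl
  lintegral_le x _ F hF := by
    by_cases hx : x ∈ A
    · simpa [hx] using h.lintegral_le x hx F hF
    · simpa [hx] using (h' x).lintegral_le x rfl F hF

/-- On the inputs outside `A`, the kernel guesses the input, and the guess is right with probability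
at least `δ / n` for an alphabet of `n` inputs. -/
theorem IsCausalBound.exists_univ [Finite (∀ i, X i)] [Nonempty (∀ i, X i)]
    [StandardBorelSpace (Y j)] [Nonempty (Y j)] [IsMarkovKernel ch]
    (h : IsCausalBound ch A s j ℓ q) {δ : ℝ} (hδ : 0 < δ) (hδ_lt : δ < 1) :
    ∃ ℓ' q', IsCausalBound ch Set.univ s j ℓ' q' ∧
      ∀ x ∈ A, condMean ch s j ℓ' x = condMean ch s j ℓ x - Real.log (1 - δ) := by
  classical
  have : Fintype (∀ i, X i) := .ofFinite _
  have := h.isMarkovKernel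
  have hn : (0 : ℝ) < Fintype.card (∀ i, X i) := Nat.cast_pos.2 Fintype.card_pos
  have hδn : 0 < δ / Fintype.card (∀ i, X i) := div_pos hδ hn
  let p : Option (∀ i, X i) → ℝ≥0∞ := fun o =>
    o.elim (.ofReal (1 - δ)) fun _ => .ofReal (δ / Fintype.card (∀ i, X i))
  let κ : Option (∀ i, X i) → Kernel ((∀ l : Set.Iio j, X l) × ∀ l : s, Y l) (Y j) := fun o =>
    o.elim q fun x => (condDistrib (fun y => y j) s.domRestrict (ch x)).comap Prod.snd
      measurable_snd
  have hp : ∑ o, p o = 1 := by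
    simp only [p, Fintype.sum_option, Option.elim, Finset.sum_const, Finset.card_univ,
      nsmul_eq_mul]
    rw [← ENNReal.ofReal_natCast, ← ENNReal.ofReal_mul hn.le, mul_div_cancel₀ _ hn.ne',
      ← ENNReal.ofReal_add (by linarith) hδ.le, sub_add_cancel, ENNReal.ofReal_one]
  have hκ : ∀ o, IsMarkovKernel (κ o) := by
    rintro (_ | x) <;> simp only [κ, Option.elim] <;> infer_instance
  obtain ⟨q', hq', hq'_le⟩ := exists_isMarkovKernel_smul_le hp κ
  refine ⟨_, q', (h.sub_log (sub_pos.2 hδ_lt) (hq'_le none)).piecewise fun x =>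
    (isCausalBound_condDistrib x).sub_log hδn (hq'_le (some x)), fun x hx => ?_⟩
  simp only [condMean, Set.piecewise_eq_of_mem _ _ _ hx]
  rw [integral_sub (h.integrable x hx) (integrable_const _)]
  simp

end Extension

section Region

lemma exists_tendsto_integral_of_finite {ι α : Type*} [Finite α] [MeasurableSpace α]
    [MeasurableSingletonClass α] (l : Filter ι) [l.NeBot] (P : ι → ProbabilityMeasure α) :
    ∃ (P₀ : ProbabilityMeasure α) (u : Ultrafilter ι), ↑u ≤ l ∧
      ∀ f : α → ℝ, Tendsto (fun i => ∫ x, f x ∂P i) u (𝓝 (∫ x, f x ∂P₀)) := by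
  let _ : TopologicalSpace α := ⊥
  have : DiscreteTopology α := ⟨rfl⟩
  exact ⟨_, .of l, Ultrafilter.of_le l, fun f =>
    ProbabilityMeasure.tendsto_iff_forall_integral_tendsto.1
      ((Ultrafilter.of l).map P).le_nhds_lim (.mkOfCompact ⟨f, continuous_of_discreteTopology⟩)⟩

lemma ofReal_le_sum_of_toReal_le {ι : Type*} {J : Finset ι} {I : ι → ℝ≥0∞} {r : ℝ}
    (h : (∀ j ∈ J, I j ≠ ∞) → r ≤ ∑ j ∈ J, (I j).toReal) :
    ENNReal.ofReal r ≤ ∑ j ∈ J, I j := by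
  by_cases hI : ∀ j ∈ J, I j ≠ ∞
  · rw [← ENNReal.toReal_sum hI] at h
    exact ENNReal.ofReal_le_of_le_toReal (h hI)
  · push Not at hI
    rw [ENNReal.sum_eq_top.2 hI]
    exact le_top

lemma sum_max_sub_le {ι : Type*} (J : Finset ι) {R : ι → ℝ} (hR : ∀ i, 0 ≤ R i) {η : ℝ}
    (hη : 0 ≤ η) : ∑ j ∈ J, max (R j - η) 0 ≤ max (∑ j ∈ J, R j - η) 0 := by
  classical
  by_cases h : ∃ j ∈ J, η ≤ R j
  · obtain ⟨j, hj, hle⟩ := h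
    have herase : ∑ l ∈ J.erase j, max (R l - η) 0 ≤ ∑ l ∈ J.erase j, R l :=
      Finset.sum_le_sum fun l _ => max_le (by linarith) (hR l)
    refine le_max_of_le_left ?_
    rw [← Finset.add_sum_erase _ _ hj, ← Finset.add_sum_erase _ _ hj, max_eq_left (by linarith)]
    linarith
  · push Not at h
    exact le_max_of_le_right <| Finset.sum_nonpos fun j hj => max_le (by linarith [h j hj]) le_rfl

variable {K : ℕ} {X Y : Fin K → Type*} [∀ i, MeasurableSpace (X i)] [∀ i, MeasurableSpace (Y i)]
  {R : Fin K → ℝ}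

lemma mem_outerRegion_of_forall_isCausalInformation
    [∀ i, StandardBorelSpace (X i)] [∀ i, Nonempty (X i)]
    [∀ i, StandardBorelSpace (Y i)] [∀ i, Nonempty (Y i)] {ch : Kernel (∀ i, X i) (∀ i, Y i)}
    (hR : ∀ i, 0 ≤ R i) (P : Measure (∀ i, X i)) [IsProbabilityMeasure P]
    (h : ∀ (ch' : Kernel (∀ i, X i) (∀ i, Y i)) [IsMarkovKernel ch'], SameMarginals ch ch' →
      ∀ (J : Finset (Fin K)) (s : Fin K → Set (Fin K)), (∀ j ∈ J, s j = {l | l ∈ J ∧ l < j}) →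
      ∀ r : Fin K → ℝ, (∀ j, 0 ≤ r j) → (∀ j ∈ J, IsCausalInformation P ch' (s j) j (r j)) →
        ∑ j ∈ J, R j ≤ ∑ j ∈ J, r j) : R ∈ outerRegion ch := by
  refine ⟨hR, P, inferInstance, fun ch' _ hch => ⟨fun i => ?_, fun i => ?_⟩⟩
  · have hi := ofReal_le_sum_of_toReal_le (J := {i}) (I := singleBound P ch')
      (r := ∑ j ∈ {i}, R j) fun hI =>
        h ch' hch {i} (fun _ => ∅) (by grind) _ (fun _ => ENNReal.toReal_nonneg) fun j hj =>
          isCausalInformation_toReal_singleBound P ch' (hI j hj)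
    simpa only [Finset.sum_singleton] using hi
  · exact ofReal_le_sum_of_toReal_le fun hI =>
      h ch' hch (Finset.Ici i) (fun j => Set.Ico i j) (fun j _ => by grind) _
        (fun _ => ENNReal.toReal_nonneg) fun j hj =>
          isCausalInformation_toReal_progressiveTerm P ch' (hI j hj)

namespace Code

section Nonasymptotic

variable {N : ℕ} [NeZero N] (c : Code X Y (fun i => numMessages N (R i)) N) (hR : ∀ i, 0 ≤ R i)
  (ch : Kernel (∀ i, X i) (∀ i, Y i)) [IsMarkovKernel ch]

include hR

lemma isProbabilityMeasure_inputLaw : IsProbabilityMeasure c.inputLaw :=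
  have : ∀ i, NeZero (numMessages N (R i)) := fun i => ⟨(numMessages_pos (hR i)).ne'⟩
  inferInstance

lemma sum_sub_rateLoss_le_sum [∀ i, MeasurableSingletonClass (X i)] [∀ i, Nonempty (Y i)]
    {ch ch' : Kernel (∀ i, X i) (∀ i, Y i)} [IsMarkovKernel ch] [IsMarkovKernel ch']
    (hch : SameMarginals ch ch') {J : Finset (Fin K)} {s : Fin K → Set (Fin K)}
    (hs : ∀ j ∈ J, s j = {l | l ∈ J ∧ l < j}) {r : Fin K → ℝ}
    (h : ∀ j ∈ J, IsCausalInformation c.inputLaw ch' (s j) j (r j)) :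
    ∑ j ∈ J, R j - c.rateLoss ch R ≤ ∑ j ∈ J, r j := by
  choose! ℓ q hbound hint hmean using h
  refine le_of_mul_le_mul_left ?_ (Real.log_pos one_lt_two)
  calc Real.log 2 * (∑ j ∈ J, R j - c.rateLoss ch R)
      ≤ ∫ x, ∑ j ∈ J, condMean ch' (s j) j (ℓ j) x ∂c.inputLaw :=
        c.log_two_mul_sub_rateLoss_le_integral_inputLaw hR hch hs c.inputLaw_singleton_ne_zero
          hbound
    _ = Real.log 2 * ∑ j ∈ J, r j := by
        rw [integral_finsetSum _ hint, Finset.sum_congr rfl hmean, Finset.mul_sum]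

theorem max_sub_rateLoss_mem_outerRegion [∀ i, StandardBorelSpace (X i)] [∀ i, Nonempty (X i)]
    [∀ i, StandardBorelSpace (Y i)] [∀ i, Nonempty (Y i)] :
    (fun j => max (R j - c.rateLoss ch R) 0) ∈ outerRegion ch := by
  have := c.isProbabilityMeasure_inputLaw hR
  exact mem_outerRegion_of_forall_isCausalInformation (fun _ => le_max_right _ _) c.inputLaw
    fun ch' _ hch J s hs r hr h =>
      (sum_max_sub_le J hR (c.rateLoss_nonneg hR)).trans
        (max_le (c.sum_sub_rateLoss_le_sum hR hch hs h) (Finset.sum_nonneg fun j _ => hr j))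

end Nonasymptotic
end Code

variable [∀ i, StandardBorelSpace (X i)] [∀ i, Nonempty (X i)]
  [∀ i, StandardBorelSpace (Y i)] [∀ i, Nonempty (Y i)]

theorem capacityRegion_subset_closure_outerRegion (ch : Kernel (∀ i, X i) (∀ i, Y i))
    [IsMarkovKernel ch] : capacityRegion ch ⊆ closure (outerRegion ch) := by
  rintro R ⟨hR, c, hc⟩
  refine mem_closure_of_tendsto (f := fun N j => max (R j - (c N).rateLoss ch R) 0) (b := atTop)
    (tendsto_pi_nhds.2 fun j => ?_) ?_
  · have h := ((Code.tendsto_rateLoss hc).const_sub (R j)).max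
      (tendsto_const_nhds (x := (0 : ℝ)))
    rwa [sub_zero, max_eq_left (hR j)] at h
  · filter_upwards [eventually_ne_atTop 0] with N hN
    have : NeZero N := ⟨hN⟩
    exact (c N).max_sub_rateLoss_mem_outerRegion hR ch

end Region

section FiniteAlphabets

variable {K : ℕ} {X Y : Fin K → Type*} [∀ i, MeasurableSpace (X i)] [∀ i, MeasurableSpace (Y i)]
  {R : Fin K → ℝ} {ch : Kernel (∀ i, X i) (∀ i, Y i)} [∀ i, Finite (X i)]

lemma IsCausalInformation.exists_univ [∀ i, Nonempty (X i)]
    {j : Fin K} [StandardBorelSpace (Y j)] [Nonempty (Y j)] [IsMarkovKernel ch]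
    {P : Measure (∀ i, X i)} [IsProbabilityMeasure P] {s : Set (Fin K)} {r : ℝ}
    (h : IsCausalInformation P ch s j r) {δ : ℝ} (hδ : 0 < δ) (hδ_lt : δ < 1) :
    ∃ ℓ q, IsCausalBound ch Set.univ s j ℓ q ∧
      ∫ x, condMean ch s j ℓ x ∂P = Real.log 2 * r - Real.log (1 - δ) := by
  obtain ⟨ℓ, q, hbound, hint, hmean⟩ := h
  obtain ⟨ℓ', q', hbound', heq⟩ := hbound.exists_univ hδ hδ_lt
  refine ⟨ℓ', q', hbound', ?_⟩
  have hatoms : ∀ᵐ x ∂P, P {x} ≠ 0 := by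
    rw [ae_iff]
    refine (measure_null_iff_singleton (Set.to_countable _)).2 fun x hx => ?_
    simpa using hx
  calc ∫ x, condMean ch s j ℓ' x ∂P
      = ∫ x, (condMean ch s j ℓ x - Real.log (1 - δ)) ∂P :=
        integral_congr_ae (hatoms.mono heq)
    _ = Real.log 2 * r - Real.log (1 - δ) := by
        rw [integral_sub hint (integrable_const _), hmean, integral_const, probReal_univ,
          one_smul]

lemma sum_le_sum_of_tendsto_integral_inputLaw [∀ i, MeasurableSingletonClass (X i)]
    [∀ i, Nonempty (X i)] [∀ i, StandardBorelSpace (Y i)] [∀ i, Nonempty (Y i)]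
    [IsMarkovKernel ch] (hR : ∀ i, 0 ≤ R i) {c : ∀ N, Code X Y (fun i => numMessages N (R i)) N}
    (hc : Tendsto (fun N => (c N).errorProb ch) atTop (𝓝 0))
    {l : Filter ℕ} [l.NeBot] (hl : l ≤ atTop) {P : Measure (∀ i, X i)} [IsProbabilityMeasure P]
    (hP : ∀ f : (∀ i, X i) → ℝ,
      Tendsto (fun n => ∫ x, f x ∂(c (n + 1)).inputLaw) l (𝓝 (∫ x, f x ∂P)))
    {ch' : Kernel (∀ i, X i) (∀ i, Y i)} [IsMarkovKernel ch'] (hch : SameMarginals ch ch')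
    {J : Finset (Fin K)} {s : Fin K → Set (Fin K)} (hs : ∀ j ∈ J, s j = {l | l ∈ J ∧ l < j})
    {r : Fin K → ℝ} (h : ∀ j ∈ J, IsCausalInformation P ch' (s j) j (r j)) :
    ∑ j ∈ J, R j ≤ ∑ j ∈ J, r j := by
  have hrate : Tendsto (fun n => Real.log 2 * (∑ j ∈ J, R j - (c (n + 1)).rateLoss ch R)) l
      (𝓝 (Real.log 2 * ∑ j ∈ J, R j)) := by
    have h_loss := ((Code.tendsto_rateLoss hc).comp (tendsto_add_atTop_nat 1)).mono_left hl
    simpa using (h_loss.const_sub (∑ j ∈ J, R j)).const_mul (Real.log 2)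
  have hle : ∀ δ ∈ Set.Ioo (0 : ℝ) 1, Real.log 2 * ∑ j ∈ J, R j ≤
      ∑ j ∈ J, (Real.log 2 * r j - Real.log (1 - δ)) := fun δ ⟨hδ, hδ_lt⟩ => by
    choose! ℓ q hbound hmean using fun j (hj : j ∈ J) => (h j hj).exists_univ hδ hδ_lt
    rw [← Finset.sum_congr rfl hmean, ← integral_finsetSum _ fun _ _ => .of_finite]
    exact le_of_tendsto_of_tendsto' hrate (hP _) fun n =>
      (c (n + 1)).log_two_mul_sub_rateLoss_le_integral_inputLaw hR hch hs
        (fun _ _ => Set.mem_univ _) hbound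
  have hlim : Tendsto (fun δ : ℝ => ∑ j ∈ J, (Real.log 2 * r j - Real.log (1 - δ))) (𝓝[>] 0)
      (𝓝 (Real.log 2 * ∑ j ∈ J, r j)) := by
    have hcont : ContinuousAt (fun δ : ℝ => ∑ j ∈ J, (Real.log 2 * r j - Real.log (1 - δ))) 0 := by
      fun_prop (disch := norm_num)
    simpa [Finset.mul_sum] using hcont.tendsto.mono_left (nhdsWithin_le_nhds (s := Set.Ioi 0))
  exact le_of_mul_le_mul_left
    (ge_of_tendsto hlim (mem_of_superset (Ioo_mem_nhdsGT zero_lt_one) hle))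
    (Real.log_pos one_lt_two)

theorem capacityRegion_subset_outerRegion_of_finite [∀ i, StandardBorelSpace (X i)]
    [∀ i, Nonempty (X i)] [∀ i, StandardBorelSpace (Y i)] [∀ i, Nonempty (Y i)]
    (ch : Kernel (∀ i, X i) (∀ i, Y i)) [IsMarkovKernel ch] :
    capacityRegion ch ⊆ outerRegion ch := by
  rintro R ⟨hR, c, hc⟩
  obtain ⟨P, u, hu, hP⟩ := exists_tendsto_integral_of_finite atTop fun n =>
    (⟨(c (n + 1)).inputLaw, (c (n + 1)).isProbabilityMeasure_inputLaw hR⟩ :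
      ProbabilityMeasure (∀ i, X i))
  exact mem_outerRegion_of_forall_isCausalInformation hR P fun ch' _ hch J s hs r _ h =>
    sum_le_sum_of_tendsto_integral_inputLaw hR hc hu hP hch hs h

end FiniteAlphabets

end CIFC

theorem mainTheorem1 {K : ℕ} {X Y : Fin K → Type*}
    [∀ i, MeasurableSpace (X i)] [∀ i, StandardBorelSpace (X i)] [∀ i, Nonempty (X i)]
    [∀ i, MeasurableSpace (Y i)] [∀ i, StandardBorelSpace (Y i)] [∀ i, Nonempty (Y i)]
    (ch : Kernel (∀ i, X i) (∀ i, Y i)) [IsMarkovKernel ch] :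
    ((∀ i, Finite (X i)) → CIFC.capacityRegion ch ⊆ CIFC.outerRegion ch) ∧
      CIFC.capacityRegion ch ⊆ closure (CIFC.outerRegion ch) :=
  ⟨fun _ => CIFC.capacityRegion_subset_outerRegion_of_finite ch,
    CIFC.capacityRegion_subset_closure_outerRegion ch⟩
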